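/- Let $d_1,d_2,d_Y\ge 0$ be integers and let $\Delta$ be the set of Borel probability measures on $\mathbb{R}^{d_1}\times\mathbb{R}^{d_2}\times\mathbb{R}^{d_Y}$, regarded as laws of random vectors $(X_1,X_2,Y)$. "Gaussian" includes degenerate Gaussian laws. For $q\in\Delta$, with $X=(X_1,X_2)$, let $$h_q(Y|X_1,X_2)=-\int q_X(dx)\int f(y|x)\log f(y|x)\,dy\in[-\infty,\infty],$$ where $f(y|x)$ is the density of $q$ with respect to $q_X\otimes\mathrm{Lebesgue}$, and $h_q(Y|X_1,X_2)=-\infty$ if there is no such density. Let $I_q(X_1,X_2;Y)$, $I_q(X_i;Y)$ and $I_q(X_i;Y|X_j)$ be the (conditional) mutual informations under $q$, with values in $[0,\infty]$, and let $I_q(X_1;X_2;Y)=I_q(X_1;Y)-I_q(X_1;Y|X_2)$. (a) Let $q\in\Delta$ have finite first and second moments. Then there is a jointly Gaussian law with the same mean and covariance as $q$, and for such a law $\hat q$, $$h_q(Y|X_1,X_2)\le h_{\hat q}(Y|X_1,X_2).$$ (b) Let $p\in\Delta$ be such that the marginal laws $p(x_1,y)$ and $p(x_2,y)$ are Gaussian,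 and let $\Delta_p^{\mathrm G}$ be the set of all $q\in\Delta$ with $q(x_1,y)=p(x_1,y)$ and $q(x_2,y)=p(x_2,y)$. Then each of the problems $$\min_{q\in\Delta_p^{\mathrm G}} I_q(X_1,X_2;Y),\quad \min_{q\in\Delta_p^{\mathrm G}} I_q(X_1;Y|X_2),\quad \min_{q\in\Delta_p^{\mathrm G}} I_q(X_2;Y|X_1),\quad \max_{q\in\Delta_p^{\mathrm G}} I_q(X_1;X_2;Y)$$ has an optimizer that is jointly Gaussian. Consequently the GPID values $$R=\max_{q} I_q(X_1;X_2;Y),\quad U_1=\min_{q} I_q(X_1;Y|X_2),\quad U_2=\min_{q} I_q(X_2;Y|X_1),\quad S=I_p(X_1,X_2;Y)-\min_{q} I_q(X_1,X_2;Y),$$ with $q$ ranging over $\Delta_p^{\mathrm G}$, are equal to the corresponding $\sim_G$-PID values, in which $q$ ranges only over the jointly Gaussian members of $\Delta_p^{\mathrm G}$. (If informations are infinite, differences are read with the convention $\infty-\infty=-\infty$.) -/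

import Mathlib

open MeasureTheory ProbabilityTheory InformationTheory
open scoped ENNReal

namespace GPID

noncomputable section

/-! ### Information measures (natural logarithm) of random variables -/

section Information

variable {Ω A B C : Type*} [MeasurableSpace Ω] [MeasurableSpace A] [MeasurableSpace B]
  [MeasurableSpace C]

/-- The conditional density `f(y | x)`: the Radon-Nikodym density of the joint law of `(X, Y)` with
respect to `P_X ⊗ Lebesgue`. The law of `X` itself need not have a density. -/
def condDensity {n : ℕ} (P : Measure Ω) (Y : Ω → EuclideanSpace ℝ (Fin n)) (X : Ω → A) :
    A × EuclideanSpace ℝ (Fin n) → ℝ≥0∞ :=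
  (P.map fun ω => (X ω, Y ω)).rnDeriv ((P.map X).prod volume)

open Classical in
/-- The conditional differential entropy
`h(Y | X) = - ∫ P_X(dx) ∫ f(y | x) log f(y | x) dy`, as an extended real number: the integral of the
positive part of `- f log f` minus the integral of its negative part. It is `-∞` if `(X, Y)` is not
absolutely continuous with respect to `P_X ⊗ Lebesgue`, that is, if the conditional law of `Y`
given `X` fails to have a density with positive probability. -/
def condDiffEntropy {n : ℕ} (P : Measure Ω) (Y : Ω → EuclideanSpace ℝ (Fin n)) (X : Ω → A) :
    EReal :=
  if (P.map fun ω => (X ω, Y ω)) ≪ (P.map X).prod volume then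
    ((∫⁻ z, ENNReal.ofReal (Real.negMulLog (condDensity P Y X z).toReal)
        ∂((P.map X).prod volume) : ℝ≥0∞) : EReal)
      - ((∫⁻ z, ENNReal.ofReal (-Real.negMulLog (condDensity P Y X z).toReal)
        ∂((P.map X).prod volume) : ℝ≥0∞) : EReal)
  else ⊥

/-- The mutual information `I(X; Y) = D(P_{XY} ‖ P_X ⊗ P_Y)`. -/
def mutualInfo (P : Measure Ω) (X : Ω → A) (Y : Ω → B) : ℝ≥0∞ :=
  klDiv (P.map fun ω => (X ω, Y ω)) ((P.map X).prod (P.map Y))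

/-- The conditional mutual information
`I(X; Y | Z) = D(P_{ZXY} ‖ P_Z ⊗ (P_{X|Z} ⊗ P_{Y|Z}))`. -/
def condMutualInfo [StandardBorelSpace A] [Nonempty A] [StandardBorelSpace B] [Nonempty B]
    (P : Measure Ω) [IsFiniteMeasure P] (X : Ω → A) (Y : Ω → B) (Z : Ω → C) : ℝ≥0∞ :=
  klDiv (P.map fun ω => (Z ω, X ω, Y ω))
    ((P.map Z) ⊗ₘ (condDistrib X Z P ×ₖ condDistrib Y Z P))

end Information

/-! ### Joint distributions of `(X₁, X₂, Y)` -/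

/-- The space of values `(x₁, x₂, y)`. -/
abbrev Triple (d₁ d₂ dY : ℕ) : Type :=
  EuclideanSpace ℝ (Fin d₁) × EuclideanSpace ℝ (Fin d₂) × EuclideanSpace ℝ (Fin dY)

/-- The set of joint distributions of `(X₁, X₂, Y)`. -/
abbrev Law (d₁ d₂ dY : ℕ) : Type := ProbabilityMeasure (Triple d₁ d₂ dY)

section Objectives

variable {d₁ d₂ dY : ℕ}

/-- The random vector `X₁`. -/
def X₁ (z : Triple d₁ d₂ dY) : EuclideanSpace ℝ (Fin d₁) := z.1

/-- The random vector `X₂`. -/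
def X₂ (z : Triple d₁ d₂ dY) : EuclideanSpace ℝ (Fin d₂) := z.2.1

/-- The random vector `Y`. -/
def Y (z : Triple d₁ d₂ dY) : EuclideanSpace ℝ (Fin dY) := z.2.2

/-- `h_q(Y | X₁, X₂)`. -/
def entropyYGivenX (q : Law d₁ d₂ dY) : EReal :=
  condDiffEntropy (q : Measure (Triple d₁ d₂ dY)) Y (fun z => (X₁ z, X₂ z))

/-- `I_q(X₁, X₂; Y)`. -/
def totalInfo (q : Law d₁ d₂ dY) : ℝ≥0∞ :=
  mutualInfo (q : Measure (Triple d₁ d₂ dY)) (fun z => (X₁ z, X₂ z)) Y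

/-- `I_q(X₁; Y | X₂)`. -/
def condInfo₁ (q : Law d₁ d₂ dY) : ℝ≥0∞ :=
  condMutualInfo (q : Measure (Triple d₁ d₂ dY)) X₁ Y X₂

/-- `I_q(X₂; Y | X₁)`. -/
def condInfo₂ (q : Law d₁ d₂ dY) : ℝ≥0∞ :=
  condMutualInfo (q : Measure (Triple d₁ d₂ dY)) X₂ Y X₁

/-- The three-way mutual information `I_q(X₁; X₂; Y) = I_q(X₁; Y) - I_q(X₁; Y | X₂)`. -/
def interactionInfo (q : Law d₁ d₂ dY) : EReal :=
  (mutualInfo (q : Measure (Triple d₁ d₂ dY)) X₁ Y : EReal) - (condInfo₁ q : EReal)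

/-- `q` is jointly Gaussian (possibly degenerate). -/
def IsJointlyGaussian (q : Law d₁ d₂ dY) : Prop :=
  IsGaussian (q : Measure (Triple d₁ d₂ dY))

/-- `q` has finite first and second moments. -/
def HasFiniteMoments (q : Law d₁ d₂ dY) : Prop :=
  MemLp id 2 (q : Measure (Triple d₁ d₂ dY))

/-- `q'` is jointly Gaussian with the same mean and the same covariance as `q`. -/
def IsGaussianMatch (q q' : Law d₁ d₂ dY) : Prop :=
  IsJointlyGaussian q' ∧
  (∫ z, z ∂(q' : Measure (Triple d₁ d₂ dY))) = ∫ z, z ∂(q : Measure (Triple d₁ d₂ dY)) ∧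
  covarianceBilinDual (q' : Measure (Triple d₁ d₂ dY)) =
    covarianceBilinDual (q : Measure (Triple d₁ d₂ dY))

/-! ### Partial information decompositions -/

/-- The law of `(X₁, Y)` under `q`. -/
def marginal₁ (q : Law d₁ d₂ dY) :
    Measure (EuclideanSpace ℝ (Fin d₁) × EuclideanSpace ℝ (Fin dY)) :=
  (q : Measure (Triple d₁ d₂ dY)).map fun z => (X₁ z, Y z)

/-- The law of `(X₂, Y)` under `q`. -/
def marginal₂ (q : Law d₁ d₂ dY) :
    Measure (EuclideanSpace ℝ (Fin d₂) × EuclideanSpace ℝ (Fin dY)) :=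
  (q : Measure (Triple d₁ d₂ dY)).map fun z => (X₂ z, Y z)

/-- `Δ^G`: the laws whose pairwise marginals of `(X₁, Y)` and of `(X₂, Y)` are Gaussian. -/
def pairwiseGaussian (d₁ d₂ dY : ℕ) : Set (Law d₁ d₂ dY) :=
  {q | IsGaussian (marginal₁ q) ∧ IsGaussian (marginal₂ q)}

/-- `Δ_p^G`: the laws in `Δ^G` with the same pairwise marginals as `p`. -/
def feasible (p : Law d₁ d₂ dY) : Set (Law d₁ d₂ dY) :=
  {q | q ∈ pairwiseGaussian d₁ d₂ dY ∧ marginal₁ q = marginal₁ p ∧ marginal₂ q = marginal₂ p}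

/-- The jointly Gaussian laws with the same pairwise marginals as `p`. -/
def gaussianFeasible (p : Law d₁ d₂ dY) : Set (Law d₁ d₂ dY) :=
  {q | IsJointlyGaussian q ∧ marginal₁ q = marginal₁ p ∧ marginal₂ q = marginal₂ p}

/-- The four values of a partial information decomposition. -/
@[ext]
structure Decomposition where
  /-- redundant information -/
  R : EReal
  /-- information unique to `X₁` -/
  U₁ : EReal
  /-- information unique to `X₂` -/
  U₂ : EReal
  /-- synergistic information -/
  S : EReal

/-- The decomposition of `I_p(X₁, X₂; Y)` obtained by optimizing over a set `D` of laws. -/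
def decomposition (p : Law d₁ d₂ dY) (D : Set (Law d₁ d₂ dY)) : Decomposition where
  R := ⨆ q ∈ D, interactionInfo q
  U₁ := ⨅ q ∈ D, (condInfo₁ q : EReal)
  U₂ := ⨅ q ∈ D, (condInfo₂ q : EReal)
  S := (totalInfo p : EReal) - ⨅ q ∈ D, (totalInfo q : EReal)

/-- GPID: optimization over all laws in `Δ_p^G`. -/
def gpid (p : Law d₁ d₂ dY) : Decomposition := decomposition p (feasible p)

/-- `∼_G`-PID: optimization restricted to jointly Gaussian laws. -/
def tildeGpid (p : Law d₁ d₂ dY) : Decomposition := decomposition p (gaussianFeasible p)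

end Objectives

end

end GPID

/-!
Up to an explicit function of the mean and the covariance, each quantity is a divergence
`D(law of (X, V) ‖ P_X ⊗ N(0, I))` for an affine image `(X, V)` of `(X₁, X₂, Y)`. For the entropy,
`V = Y`; for `I(X; Y)`, `V` is the whitened `Y`, whose law is fixed by the constraints; for
`I(U; Y | Z)`, `V` is the whitened residual of the regression of `Y` on `Z`, which is independent
of `Z` because `(Z, Y)` is Gaussian, and the information equals `I((Z, U); V)`.

By the Donsker-Varadhan inequality, tested against the log-densities of nondegenerate Gaussian
regression models of `V` on `X`, this divergence is at least a supremum of functions which depend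
only on the mean and the covariance of `(X, V)`, with equality for Gaussian laws. Hence replacing a
law by the Gaussian with the same moments does not increase the divergence. The supremum is lower
semicontinuous in the covariance, and the covariances compatible with the prescribed marginals form
a compact set, so the minimum is attained.
-/

set_option maxSynthPendingDepth 3

namespace GPID

noncomputable section

/-! ### Kullback-Leibler divergence and exponential tilting -/

section Tilting

variable {α β : Type*} [MeasurableSpace α] [MeasurableSpace β] {μ ν : Measure α} {f : α → ℝ}

theorem ofReal_integral_le_klDiv [IsProbabilityMeasure μ] [IsProbabilityMeasure ν]
    (hf : Integrable f μ) (hexp : Integrable (fun x => Real.exp (f x)) ν)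
    (h_one : ∫ x, Real.exp (f x) ∂ν = 1) :
    ENNReal.ofReal (∫ x, f x ∂μ) ≤ klDiv μ ν := by
  by_cases htop : klDiv μ ν = ∞
  · exact htop ▸ le_top
  obtain ⟨hac, hllr⟩ := klDiv_ne_top_iff.1 htop
  have : IsProbabilityMeasure (ν.tilted f) := isProbabilityMeasure_tilted hexp
  have htilted_nonneg : 0 ≤ ∫ x, llr μ (ν.tilted f) x ∂μ := by
    simpa using integral_llr_add_sub_measure_univ_nonneg
      (hac.trans (absolutelyContinuous_tilted hexp))
      (integrable_llr_tilted_right hac hf hllr hexp)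
  rw [integral_llr_tilted_right hac hf hexp hllr, h_one, Real.log_one, add_zero] at htilted_nonneg
  rw [klDiv_of_ac_of_integrable hac hllr]
  refine ENNReal.ofReal_le_ofReal ?_
  simpa using sub_nonneg.1 htilted_nonneg

theorem klDiv_withDensity_exp [IsProbabilityMeasure ν]
    (hexp : Integrable (fun x => Real.exp (f x)) ν) (h_one : ∫ x, Real.exp (f x) ∂ν = 1)
    (hμ : μ = ν.withDensity fun x => ENNReal.ofReal (Real.exp (f x))) (hf : Integrable f μ) :
    klDiv μ ν = ENNReal.ofReal (∫ x, f x ∂μ) := by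
  have hμ_tilted : μ = ν.tilted f := by simp [hμ, Measure.tilted, h_one]
  have : IsProbabilityMeasure μ := hμ_tilted ▸ isProbabilityMeasure_tilted hexp
  have hac : μ ≪ ν := hμ_tilted ▸ tilted_absolutelyContinuous ν f
  have hllr : llr μ ν =ᵐ[μ] f := by
    have hlog := log_rnDeriv_tilted_left_self hexp
    rw [← hμ_tilted, h_one, Real.log_one] at hlog
    filter_upwards [hac.ae_le hlog] with x hx
    simpa [llr] using hx
  rw [klDiv_of_ac_of_integrable hac (hf.congr hllr.symm), integral_congr_ae hllr]
  simp

theorem klDiv_map_eq_of_ae_leftInverse [IsFiniteMeasure μ] [IsFiniteMeasure ν]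
    {g : α → β} {g' : β → α} (hg : Measurable g) (hg' : Measurable g')
    (hμ : ∀ᵐ x ∂μ, g' (g x) = x) (hν : ∀ᵐ x ∂ν, g' (g x) = x) :
    klDiv (μ.map g) (ν.map g) = klDiv μ ν := by
  have map_map_inverse {ρ : Measure α} (hρ : ∀ᵐ x ∂ρ, g' (g x) = x) :
      (ρ.map g).map g' = ρ := by
    rw [Measure.map_map hg' hg]
    exact (Measure.map_congr hρ).trans Measure.map_id
  refine le_antisymm (klDiv_map_le μ ν hg) ?_
  calc klDiv μ ν = klDiv ((μ.map g).map g') ((ν.map g).map g') := by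
        rw [map_map_inverse hμ, map_map_inverse hν]
    _ ≤ klDiv (μ.map g) (ν.map g) := klDiv_map_le _ _ hg'

end Tilting

/-! ### The density of the standard Gaussian measure -/

section StdGaussianDensity

variable {V : Type*} [NormedAddCommGroup V] [InnerProductSpace ℝ V]

/-- The density of the standard Gaussian measure on a Euclidean space `V`. -/
def stdGaussianDensity (w : V) : ℝ :=
  (2 * Real.pi) ^ (-(Module.finrank ℝ V / 2 : ℝ)) * Real.exp (-(1 / 2) * ‖w‖ ^ 2)

theorem stdGaussianDensity_pos (w : V) : 0 < stdGaussianDensity w := by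
  unfold stdGaussianDensity; positivity

theorem log_stdGaussianDensity (w : V) :
    Real.log (stdGaussianDensity w) =
      -(Module.finrank ℝ V / 2 : ℝ) * Real.log (2 * Real.pi) - (1 / 2) * ‖w‖ ^ 2 := by
  unfold stdGaussianDensity
  rw [Real.log_mul (by positivity) (by positivity), Real.log_exp, Real.log_rpow (by positivity)]
  ring

variable [MeasurableSpace V] [BorelSpace V]

@[fun_prop]
theorem measurable_stdGaussianDensity : Measurable (stdGaussianDensity : V → ℝ) := by
  unfold stdGaussianDensity; fun_prop

variable [FiniteDimensional ℝ V]

theorem integrable_stdGaussianDensity : Integrable (stdGaussianDensity : V → ℝ) := by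
  have h := (GaussianFourier.integrable_cexp_neg_mul_sq_norm_add (V := V) (b := 1 / 2)
    (by norm_num) 0 0).norm
  unfold stdGaussianDensity
  refine (h.congr (.of_forall fun w => ?_)).const_mul _
  simp [Complex.norm_exp, ← Complex.ofReal_pow]

theorem integral_stdGaussianDensity_smul_cexp (t : V) :
    ∫ w : V, stdGaussianDensity w • Complex.exp (inner ℝ w t * Complex.I) =
      Complex.exp (-‖t‖ ^ 2 / 2) := by
  have hsplit (w : V) : stdGaussianDensity w • Complex.exp (inner ℝ w t * Complex.I) =
      ((2 * Real.pi : ℝ) : ℂ) ^ (-(Module.finrank ℝ V / 2 : ℂ)) *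
        Complex.exp (-(1 / 2) * ‖w‖ ^ 2 + Complex.I * inner ℝ t w) := by
    rw [Complex.real_smul, stdGaussianDensity, Complex.exp_add, Complex.ofReal_mul,
      Complex.ofReal_cpow (by positivity), real_inner_comm, mul_comm Complex.I]
    push_cast
    ring
  have h_two_pi : (Real.pi : ℂ) / (1 / 2) = ((2 * Real.pi : ℝ) : ℂ) := by push_cast; ring
  have h_two_pi_ne : ((2 * Real.pi : ℝ) : ℂ) ≠ 0 := by
    exact_mod_cast (by positivity : (2 * Real.pi : ℝ) ≠ 0)
  simp_rw [hsplit]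
  rw [integral_const_mul, GaussianFourier.integral_cexp_neg_mul_sq_norm_add (by norm_num),
    h_two_pi, ← mul_assoc, ← Complex.cpow_add _ _ h_two_pi_ne, neg_add_cancel, Complex.cpow_zero,
    Complex.I_sq]
  ring_nf

theorem stdGaussian_eq_withDensity :
    stdGaussian V = volume.withDensity fun w => ENNReal.ofReal (stdGaussianDensity w) := by
  have : IsFiniteMeasure ((volume : Measure V).withDensity
      fun w => ENNReal.ofReal (stdGaussianDensity w)) :=
    isFiniteMeasure_withDensity_ofReal integrable_stdGaussianDensity.2
  refine Measure.ext_of_charFun (funext fun t => ?_)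
  rw [charFun_stdGaussian, charFun_apply, integral_withDensity_eq_integral_toReal_smul
    measurable_stdGaussianDensity.ennreal_ofReal (by simp)]
  simp_rw [ENNReal.toReal_ofReal (stdGaussianDensity_pos _).le]
  rw [integral_stdGaussianDensity_smul_cexp]

end StdGaussianDensity

/-! ### Covariance forms and second moments -/

section DualForm

variable {E F : Type*} [NormedAddCommGroup E] [NormedSpace ℝ E]
  [NormedAddCommGroup F] [NormedSpace ℝ F]

/-- The bilinear forms on the dual of `E`, in the shape of Mathlib's `covarianceBilinDual`. -/
abbrev DualForm (E : Type*) [NormedAddCommGroup E] [NormedSpace ℝ E] : Type _ :=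
  StrongDual ℝ E →L[ℝ] StrongDual ℝ E →L[ℝ] ℝ

/-- The push-forward of a form on the dual of `E` along `T`: if `β` is the covariance of a random
vector `x`, then `β.map T` is the covariance of `T x`. -/
def DualForm.map (β : DualForm E) (T : E →L[ℝ] F) : DualForm F :=
  β.bilinearComp (.precomp ℝ T) (.precomp ℝ T)

@[simp]
theorem DualForm.map_apply (β : DualForm E) (T : E →L[ℝ] F) (L₁ L₂ : StrongDual ℝ F) :
    β.map T L₁ L₂ = β (L₁ ∘L T) (L₂ ∘L T) := rfl

@[fun_prop]
theorem DualForm.continuous_map (T : E →L[ℝ] F) : Continuous fun β : DualForm E => β.map T :=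
  (ContinuousLinearMap.flipₗᵢ ..).continuous.comp
    (((ContinuousLinearMap.flipₗᵢ ..).continuous.comp
      (continuous_id.clm_comp continuous_const)).clm_comp continuous_const)

theorem DualForm.apply_add_le {β : DualForm E} (hβ : β.toBilinForm.IsPosSemidef)
    (L₁ L₂ : StrongDual ℝ E) : β (L₁ + L₂) (L₁ + L₂) ≤ 2 * (β L₁ L₁ + β L₂ L₂) := by
  have h : 0 ≤ β (L₁ - L₂) (L₁ - L₂) := hβ.nonneg _
  simp only [map_add, map_sub, add_apply, sub_apply] at h ⊢
  linarith

theorem DualForm.norm_le {β : DualForm E} (hβ : β.toBilinForm.IsPosSemidef) {C : ℝ} (hC : 0 ≤ C)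
    (h : ∀ L, β L L ≤ C * ‖L‖ ^ 2) : ‖β‖ ≤ C := by
  refine β.opNorm_le_bound₂ hC fun L₁ L₂ => abs_le_of_sq_le_sq ?_ (by positivity)
  calc β L₁ L₂ ^ 2 ≤ β L₁ L₁ * β L₂ L₂ :=
        LinearMap.BilinForm.apply_sq_le_of_symm β.toBilinForm hβ.nonneg ⟨hβ.isSymm.eq⟩ L₁ L₂
    _ ≤ (C * ‖L₁‖ ^ 2) * (C * ‖L₂‖ ^ 2) :=
        mul_le_mul (h L₁) (h L₂) (hβ.nonneg _) (by positivity)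
    _ = (C * ‖L₁‖ * ‖L₂‖) ^ 2 := by ring

end DualForm

section AffineImage

variable {E F : Type*} [NormedAddCommGroup E] [NormedSpace ℝ E] [MeasurableSpace E] [BorelSpace E]
  [NormedAddCommGroup F] [NormedSpace ℝ F] [MeasurableSpace F] [BorelSpace F] {μ : Measure E}

theorem isGaussian_map_affine [IsGaussian μ] (T : E →L[ℝ] F) (c : F) :
    IsGaussian (μ.map fun x => T x + c) := by
  have h : (μ.map fun x => T x + c) = (μ.map T).map (· + c) := by
    rw [Measure.map_map (by fun_prop) (by fun_prop)]
    rfl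
  rw [h]
  infer_instance

variable [FiniteDimensional ℝ F]

theorem memLp_id_map_affine [IsProbabilityMeasure μ] (hμ : MemLp id 2 μ) (T : E →L[ℝ] F) (c : F) :
    MemLp id 2 (μ.map fun x => T x + c) := by
  have hT : MemLp (fun x => T x + c) 2 μ := (T.comp_memLp' hμ).add (memLp_const c)
  exact (memLp_map_measure_iff (by fun_prop) (by fun_prop)).2 hT

variable [FiniteDimensional ℝ E]

theorem integral_id_map_affine [IsProbabilityMeasure μ] (hμ : MemLp id 2 μ) (T : E →L[ℝ] F)
    (c : F) : ∫ y, y ∂(μ.map fun x => T x + c) = T (∫ x, x ∂μ) + c := by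
  have hint : Integrable (fun x : E => x) μ := hμ.integrable (by norm_num)
  rw [integral_map (by fun_prop) (by fun_prop), integral_add (T.integrable_comp hint)
    (integrable_const c), T.integral_comp_comm hint]
  simp

theorem integral_id_map [IsProbabilityMeasure μ] (hμ : MemLp id 2 μ) (T : E →L[ℝ] F) :
    ∫ y, y ∂(μ.map T) = T (∫ x, x ∂μ) := by
  simpa using integral_id_map_affine hμ T 0

theorem covarianceBilinDual_map_affine [IsProbabilityMeasure μ] (hμ : MemLp id 2 μ)
    (T : E →L[ℝ] F) (c : F) :
    covarianceBilinDual (μ.map fun x => T x + c) = DualForm.map (covarianceBilinDual μ) T := by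
  have hint (L : StrongDual ℝ E) : Integrable L μ := L.integrable_comp (hμ.integrable (by norm_num))
  ext L₁ L₂
  rw [DualForm.map_apply, covarianceBilinDual_eq_covariance (memLp_id_map_affine hμ T c),
    covarianceBilinDual_eq_covariance hμ, covariance_map_fun (by fun_prop) (by fun_prop)
    (by fun_prop)]
  simp only [map_add]
  exact (covariance_add_const_left (hint (L₁ ∘L T)) _).trans
    (covariance_add_const_right (hint (L₂ ∘L T)) _)

theorem covarianceBilinDual_map [IsProbabilityMeasure μ] (hμ : MemLp id 2 μ) (T : E →L[ℝ] F) :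
    covarianceBilinDual (μ.map T) = DualForm.map (covarianceBilinDual μ) T := by
  simpa using covarianceBilinDual_map_affine hμ T 0

end AffineImage

section SqMoment

variable {V : Type*} [NormedAddCommGroup V] [InnerProductSpace ℝ V] [FiniteDimensional ℝ V]

/-- The second moment `E ‖x‖²` of a random vector `x` with mean `m` and covariance `β`: the sum of
`‖m‖²` and the trace of `β`. -/
def sqMoment (m : V) (β : DualForm V) : ℝ :=
  ‖m‖ ^ 2 + ∑ i, β (innerSL ℝ (stdOrthonormalBasis ℝ V i)) (innerSL ℝ (stdOrthonormalBasis ℝ V i))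

@[fun_prop]
theorem continuous_sqMoment (m : V) : Continuous (sqMoment m) := by
  unfold sqMoment
  fun_prop

theorem integral_norm_sq_eq_sqMoment [MeasurableSpace V] [BorelSpace V] {μ : Measure V}
    [IsProbabilityMeasure μ] (hμ : MemLp id 2 μ) :
    ∫ x, ‖x‖ ^ 2 ∂μ = sqMoment (∫ x, x ∂μ) (covarianceBilinDual μ) := by
  let b := stdOrthonormalBasis ℝ V
  have hb (i) : MemLp (innerSL ℝ (b i)) 2 μ := (innerSL ℝ (b i)).comp_memLp' hμ
  have hmean (i) : ∫ x, innerSL ℝ (b i) x ∂μ = inner ℝ (b i) (∫ x, x ∂μ) :=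
    (innerSL ℝ (b i)).integral_comp_comm (hμ.integrable (by norm_num))
  have hsq (i) : ∫ x, inner ℝ (b i) x ^ 2 ∂μ =
      inner ℝ (b i) (∫ x, x ∂μ) ^ 2 +
        covarianceBilinDual μ (innerSL ℝ (b i)) (innerSL ℝ (b i)) := by
    rw [covarianceBilinDual_self_eq_variance hμ, variance_eq_sub (hb i), hmean]
    simp
  have hparseval (x : V) : ‖x‖ ^ 2 = ∑ i, inner ℝ (b i) x ^ 2 :=
    (b.sum_sq_inner_right x).symm
  rw [sqMoment, hparseval, ← Finset.sum_add_distrib]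
  simp_rw [hparseval]
  rw [integral_finsetSum _ fun i _ => by exact (hb i).integrable_sq]
  exact Finset.sum_congr rfl fun i _ => hsq i

end SqMoment

/-! ### Lower bounds on divergences from linear regression -/

section ChangeOfVariables

variable {V : Type*} [NormedAddCommGroup V] [NormedSpace ℝ V] [FiniteDimensional ℝ V]
  [MeasurableSpace V] [BorelSpace V]

theorem lintegral_comp_affineEquiv (μ : Measure V) [μ.IsAddHaarMeasure] (e : V ≃L[ℝ] V) (c : V)
    {h : V → ℝ≥0∞} (hh : Measurable h) :
    ENNReal.ofReal |(e : V →L[ℝ] V).det| * ∫⁻ w, h (e w + c) ∂μ = ∫⁻ v, h v ∂μ := by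
  have hdet : (e : V →L[ℝ] V).det ≠ 0 := e.toLinearEquiv.isUnit_det'.ne_zero
  have hmap : ∫⁻ w, h (e w + c) ∂μ = ENNReal.ofReal |(e : V →L[ℝ] V).det⁻¹| * ∫⁻ v, h v ∂μ := by
    have hpush := lintegral_map (μ := μ) (f := fun v => h (v + c))
      (g := ((e : V →L[ℝ] V) : V →ₗ[ℝ] V)) (by fun_prop) e.continuous.measurable
    rw [Measure.map_linearMap_addHaar_eq_smul_addHaar _ hdet, lintegral_smul_measure,
      lintegral_add_right_eq_self h c] at hpush
    exact hpush.symm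
  rw [hmap, ← mul_assoc, ← ENNReal.ofReal_mul (abs_nonneg _), ← abs_mul, mul_inv_cancel₀ hdet]
  simp

end ChangeOfVariables

/-- A linear regression model for a random vector `w` given a random vector `x`: the conditional
law of `w` is such that `scale w + slope x + shift` is standard Gaussian. -/
structure RegressionModel (F V : Type*) [NormedAddCommGroup F] [NormedSpace ℝ F]
    [NormedAddCommGroup V] [InnerProductSpace ℝ V] where
  /-- the normalization of `w` -/
  scale : V ≃L[ℝ] V
  /-- the dependence on `x` -/
  slope : F →L[ℝ] V
  /-- the constant term -/
  shift : V

namespace RegressionModel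

variable {F V : Type*} [NormedAddCommGroup F] [NormedSpace ℝ F]
  [NormedAddCommGroup V] [InnerProductSpace ℝ V] (θ : RegressionModel F V)

/-- The linear part of the residual. -/
def residualLinear : F × V →L[ℝ] V := θ.slope.coprod θ.scale

/-- The normalized residual of an observation `(x, w)`. -/
def residual (z : F × V) : V := θ.residualLinear z + θ.shift

theorem residual_apply (x : F) (w : V) :
    θ.residual (x, w) = θ.scale w + (θ.slope x + θ.shift) := by
  simp only [residual, residualLinear, ContinuousLinearMap.coprod_apply,
    ContinuousLinearEquiv.coe_coe]
  abel

/-- The observation with explanatory variable `z.1` and normalized residual `z.2`. -/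
def sample (z : F × V) : F × V := (z.1, θ.scale.symm (z.2 - (θ.slope z.1 + θ.shift)))

theorem sample_residual (z : F × V) : θ.sample (z.1, θ.residual z) = z := by
  obtain ⟨x, w⟩ := z
  simp [sample, residual_apply]

/-- The logarithm of the density of the conditional law of `w` given `x` with respect to the
standard Gaussian measure. -/
def logDensity (z : F × V) : ℝ :=
  Real.log |(θ.scale : V →L[ℝ] V).det| - (1 / 2) * ‖θ.residual z‖ ^ 2 + (1 / 2) * ‖z.2‖ ^ 2

theorem exp_logDensity_mul_stdGaussianDensity (z : F × V) :
    Real.exp (θ.logDensity z) * stdGaussianDensity z.2 =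
      |(θ.scale : V →L[ℝ] V).det| * stdGaussianDensity (θ.residual z) := by
  have hdet : 0 < |(θ.scale : V →L[ℝ] V).det| := abs_pos.2 θ.scale.toLinearEquiv.isUnit_det'.ne_zero
  refine Real.log_injOn_pos (mul_pos (Real.exp_pos _) (stdGaussianDensity_pos _))
    (mul_pos hdet (stdGaussianDensity_pos _)) ?_
  rw [Real.log_mul (Real.exp_pos _).ne' (stdGaussianDensity_pos _).ne',
    Real.log_mul hdet.ne' (stdGaussianDensity_pos _).ne', Real.log_exp, log_stdGaussianDensity,
    log_stdGaussianDensity, logDensity]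
  ring

variable [MeasurableSpace F] [MeasurableSpace V] {π : Measure (F × V)} [IsProbabilityMeasure π]

theorem integrable_norm_residual_sq (hπ : MemLp id 2 π) :
    Integrable (fun z => ‖θ.residual z‖ ^ 2) π :=
  ((θ.residualLinear.comp_memLp' hπ).add (memLp_const θ.shift)).integrable_norm_pow (by norm_num)

theorem integrable_logDensity (hπ : MemLp id 2 π) : Integrable θ.logDensity π :=
  ((integrable_const _).sub ((θ.integrable_norm_residual_sq hπ).const_mul _)).add
    ((hπ.snd.integrable_norm_pow (by norm_num)).const_mul _)

variable [BorelSpace F] [FiniteDimensional ℝ V] [BorelSpace V]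

@[fun_prop]
theorem measurable_residual : Measurable θ.residual := by
  unfold residual residualLinear
  simp only [ContinuousLinearMap.coprod_apply]
  fun_prop

@[fun_prop]
theorem measurable_sample : Measurable θ.sample := by unfold sample; fun_prop

@[fun_prop]
theorem measurable_logDensity : Measurable θ.logDensity := by unfold logDensity; fun_prop

theorem map_sample_prod_stdGaussian (ν : Measure F) :
    (ν.prod (stdGaussian V)).map θ.sample =
      (ν.prod (stdGaussian V)).withDensity fun z => ENNReal.ofReal (Real.exp (θ.logDensity z)) := by
  have hφ : Measurable fun w : V => ENNReal.ofReal (stdGaussianDensity w) := by fun_prop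
  refine Measure.ext_of_lintegral _ fun f hf => ?_
  rw [lintegral_map hf θ.measurable_sample, lintegral_withDensity_eq_lintegral_mul _
    (by fun_prop) hf, lintegral_prod _ (by fun_prop), lintegral_prod _ (by fun_prop)]
  refine lintegral_congr fun x => ?_
  calc ∫⁻ w, f (θ.sample (x, w)) ∂stdGaussian V
      = ∫⁻ w, ENNReal.ofReal (stdGaussianDensity w) * f (θ.sample (x, w)) := by
        rw [stdGaussian_eq_withDensity, lintegral_withDensity_eq_lintegral_mul _ hφ (by fun_prop)]
        rfl
    _ = ∫⁻ w, ENNReal.ofReal |(θ.scale : V →L[ℝ] V).det| *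
          (ENNReal.ofReal (stdGaussianDensity (θ.residual (x, w))) * f (x, w)) := by
        rw [← lintegral_comp_affineEquiv volume θ.scale (θ.slope x + θ.shift) (by fun_prop),
          ← lintegral_const_mul _ (by fun_prop)]
        simp_rw [← residual_apply, θ.sample_residual (x, _)]
    _ = ∫⁻ w, ENNReal.ofReal (stdGaussianDensity w) *
          (ENNReal.ofReal (Real.exp (θ.logDensity (x, w))) * f (x, w)) := by
        refine lintegral_congr fun w => ?_
        rw [← mul_assoc, ← mul_assoc, ← ENNReal.ofReal_mul (abs_nonneg _),
          ← θ.exp_logDensity_mul_stdGaussianDensity (x, w), mul_comm (Real.exp _),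
          ENNReal.ofReal_mul (stdGaussianDensity_pos _).le]
    _ = ∫⁻ w, ENNReal.ofReal (Real.exp (θ.logDensity (x, w))) * f (x, w) ∂stdGaussian V := by
        rw [stdGaussian_eq_withDensity, lintegral_withDensity_eq_lintegral_mul _ hφ (by fun_prop)]
        rfl

theorem lintegral_exp_logDensity (ν : Measure F) [IsProbabilityMeasure ν] :
    ∫⁻ z, ENNReal.ofReal (Real.exp (θ.logDensity z)) ∂(ν.prod (stdGaussian V)) = 1 := by
  rw [← setLIntegral_univ, ← withDensity_apply _ .univ, ← map_sample_prod_stdGaussian,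
    Measure.map_apply (by fun_prop) .univ, Set.preimage_univ, measure_univ]

theorem integrable_exp_logDensity (ν : Measure F) [IsProbabilityMeasure ν] :
    Integrable (fun z => Real.exp (θ.logDensity z)) (ν.prod (stdGaussian V)) := by
  refine ⟨by fun_prop, ?_⟩
  rw [hasFiniteIntegral_iff_ofReal (.of_forall fun _ => (Real.exp_pos _).le),
    lintegral_exp_logDensity]
  exact ENNReal.one_lt_top

theorem integral_exp_logDensity (ν : Measure F) [IsProbabilityMeasure ν] :
    ∫ z, Real.exp (θ.logDensity z) ∂(ν.prod (stdGaussian V)) = 1 := by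
  rw [integral_eq_lintegral_of_nonneg_ae (.of_forall fun _ => (Real.exp_pos _).le)
    (by fun_prop), lintegral_exp_logDensity, ENNReal.toReal_one]

/-- The mean of the logarithmic density under a law with mean `m` and covariance `β`. -/
def meanLogDensity (m : F × V) (β : DualForm (F × V)) : ℝ :=
  Real.log |(θ.scale : V →L[ℝ] V).det|
    - (1 / 2) * sqMoment (θ.residual m) (β.map θ.residualLinear)
    + (1 / 2) * sqMoment m.2 (β.map (.snd ℝ F V))

variable [FiniteDimensional ℝ F]

theorem integral_logDensity (hπ : MemLp id 2 π) :
    ∫ z, θ.logDensity z ∂π = θ.meanLogDensity (∫ z, z ∂π) (covarianceBilinDual π) := by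
  have hsqMoment (T : F × V →L[ℝ] V) (c : V) : ∫ z, ‖T z + c‖ ^ 2 ∂π =
      sqMoment (T (∫ z, z ∂π) + c) (DualForm.map (covarianceBilinDual π) T) := by
    have : IsProbabilityMeasure (π.map fun z => T z + c) :=
      Measure.isProbabilityMeasure_map (by fun_prop)
    rw [← integral_id_map_affine hπ, ← covarianceBilinDual_map_affine hπ T c,
      ← integral_norm_sq_eq_sqMoment (memLp_id_map_affine hπ T c),
      integral_map (by fun_prop) (by fun_prop)]
  have hres := (θ.integrable_norm_residual_sq hπ).const_mul (1 / 2)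
  have hsnd : Integrable (fun z : F × V => (1 / 2) * ‖z.2‖ ^ 2) π :=
    (hπ.snd.integrable_norm_pow (by norm_num)).const_mul _
  have hw := hsqMoment (.snd ℝ F V) 0
  simp only [add_zero, ContinuousLinearMap.coe_snd'] at hw
  unfold logDensity meanLogDensity
  rw [integral_add (by exact (integrable_const _).sub hres) hsnd,
    integral_sub (integrable_const _) hres, integral_const_mul, integral_const_mul, hw]
  simp only [residual, hsqMoment, integral_const, probReal_univ, one_smul]

end RegressionModel

section GaussianDivBound

variable {F V : Type*} [NormedAddCommGroup F] [NormedSpace ℝ F] [NormedAddCommGroup V]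
  [InnerProductSpace ℝ V] [FiniteDimensional ℝ V]

/-- The largest lower bound given by a regression model on the divergence `stdGaussianDiv π` of a
law `π` with mean `m` and covariance `β`. -/
def gaussianDivBound (m : F × V) (β : DualForm (F × V)) : ℝ≥0∞ :=
  ⨆ θ : RegressionModel F V, ENNReal.ofReal (θ.meanLogDensity m β)

theorem lowerSemicontinuous_gaussianDivBound (m : F × V) :
    LowerSemicontinuous (gaussianDivBound m) := by
  refine lowerSemicontinuous_iSup fun θ =>
    (ENNReal.continuous_ofReal.comp ?_).lowerSemicontinuous
  unfold RegressionModel.meanLogDensity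
  fun_prop

variable [MeasurableSpace F] [BorelSpace F] [MeasurableSpace V] [BorelSpace V]

/-- The divergence of the law `π` of a pair `(x, w)` from the law of `x` times the standard Gaussian
measure. -/
def stdGaussianDiv (π : Measure (F × V)) : ℝ≥0∞ := klDiv π (π.fst.prod (stdGaussian V))

variable [FiniteDimensional ℝ F] {π : Measure (F × V)} [IsProbabilityMeasure π]

theorem gaussianDivBound_le_stdGaussianDiv (hπ : MemLp id 2 π) :
    gaussianDivBound (∫ z, z ∂π) (covarianceBilinDual π) ≤ stdGaussianDiv π := by
  refine iSup_le fun θ => ?_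
  rw [← θ.integral_logDensity hπ]
  exact ofReal_integral_le_klDiv (θ.integrable_logDensity hπ) (θ.integrable_exp_logDensity _)
    (θ.integral_exp_logDensity _)

theorem stdGaussianDiv_le_of_map_residual (hπ : MemLp id 2 π) (θ : RegressionModel F V)
    (h : π.map (fun z => (z.1, θ.residual z)) = π.fst.prod (stdGaussian V)) :
    stdGaussianDiv π ≤ gaussianDivBound (∫ z, z ∂π) (covarianceBilinDual π) := by
  have hdensity : π = (π.fst.prod (stdGaussian V)).withDensity
      fun z => ENNReal.ofReal (Real.exp (θ.logDensity z)) := by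
    rw [← θ.map_sample_prod_stdGaussian, ← h, Measure.map_map (by fun_prop) (by fun_prop)]
    simp only [Function.comp_def, θ.sample_residual, Measure.map_id']
  rw [stdGaussianDiv, klDiv_withDensity_exp (θ.integrable_exp_logDensity _)
    (θ.integral_exp_logDensity _) hdensity (θ.integrable_logDensity hπ), θ.integral_logDensity hπ]
  exact le_iSup (fun θ : RegressionModel F V => ENNReal.ofReal (θ.meanLogDensity _ _)) θ

-- A transvection along `a` does not change the residual, but has arbitrarily large determinant.
theorem gaussianDivBound_eq_top_of_ae_inner_eq_zero (hπ : MemLp id 2 π) (A : F →L[ℝ] V) (m : V)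
    {a : V} (ha : a ≠ 0) (h : ∀ᵐ z ∂π, inner ℝ a (z.2 - A z.1 - m) = 0) :
    gaussianDivBound (∫ z, z ∂π) (covarianceBilinDual π) = ∞ := by
  refine ENNReal.eq_top_of_forall_nnreal_le fun r => ?_
  let t : ℝ := (Real.exp r - 1) / ‖a‖ ^ 2
  let τ := LinearMap.transvection (innerSL ℝ a).toLinearMap (t • a)
  have hdet : LinearMap.det τ = Real.exp r := by
    rw [LinearMap.transvection.det]
    simp [t, ha]
  let θ : RegressionModel F V :=
    { scale := (LinearMap.equivOfDetNeZero τ (hdet ▸ Real.exp_ne_zero r)).toContinuousLinearEquiv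
      slope := -(t • (innerSL ℝ a).smulRight a) ∘L A
      shift := -(t • inner ℝ a m • a) }
  have hresidual (z : F × V) :
      θ.residual z = z.2 + (t * inner ℝ a (z.2 - A z.1 - m)) • a := by
    have hz : θ.residual z =
      z.2 + inner ℝ a z.2 • (t • a) + (-(t • inner ℝ a (A z.1) • a) + -(t • inner ℝ a m • a)) :=
      θ.residual_apply z.1 z.2
    rw [hz, inner_sub_right, inner_sub_right]
    module
  have hlog : θ.logDensity =ᵐ[π] fun _ => (r : ℝ) := by
    have hθ : (θ.scale : V →L[ℝ] V).det = Real.exp r := hdet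
    filter_upwards [h] with z hz
    simp [RegressionModel.logDensity, hresidual, hz, hθ]
  refine le_trans ?_ (le_iSup _ θ)
  rw [← θ.integral_logDensity hπ, integral_congr_ae hlog]
  simp

end GaussianDivBound

/-! ### Gaussian measures as affine images of standard Gaussian measures -/

section Factorization

variable {E : Type*} [NormedAddCommGroup E] [NormedSpace ℝ E] [FiniteDimensional ℝ E]
  {β : DualForm E}

theorem exists_basis_eq_sum_mul (hβ : β.toBilinForm.IsPosSemidef) :
    ∃ (N : ℕ) (e : Module.Basis (Fin N) ℝ E) (d : Fin N → ℝ), (∀ i, 0 ≤ d i) ∧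
      ∀ L₁ L₂, β L₁ L₂ = ∑ i, d i * (L₁ (e i) * L₂ (e i)) := by
  have : Invertible (2 : ℝ) := invertibleOfNonzero two_ne_zero
  obtain ⟨v, hv⟩ := LinearMap.BilinForm.exists_orthogonal_basis (B := β.toBilinForm)
    ⟨hβ.isSymm.eq⟩
  let v' : Module.Basis _ ℝ (Module.Dual ℝ E) := v.map LinearMap.toContinuousLinearMap.symm
  let e := v'.dualBasis.map (Module.evalEquiv ℝ E).symm
  have hve (i j) : v i (e j) = if i = j then 1 else 0 := by
    have heval : v i (e j) = Module.evalEquiv ℝ E (e j) (v' i) := by simp [v']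
    rw [heval, Module.Basis.map_apply, LinearEquiv.apply_symm_apply,
      Module.Basis.dualBasis_apply_self]
  have hexpand (L : StrongDual ℝ E) : L = ∑ i, L (e i) • v i := by
    refine ContinuousLinearMap.coe_injective (e.ext fun j => ?_)
    simp [hve]
  have horth (i j) (hij : j ≠ i) : β (v j) (v i) = 0 := hv hij
  refine ⟨_, e, fun i => β (v i) (v i), fun i => hβ.nonneg _, fun L₁ L₂ => ?_⟩
  conv_lhs => rw [hexpand L₁, hexpand L₂]
  simp only [map_sum, map_smul, sum_apply, smul_apply, smul_eq_mul]
  refine Finset.sum_congr rfl fun i _ => ?_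
  rw [Finset.sum_eq_single_of_mem i (Finset.mem_univ i) fun j _ hj => by simp [horth i j hj]]
  ring

theorem exists_linearIndependent_eq_sum_mul (hβ : β.toBilinForm.IsPosSemidef) :
    ∃ (k : ℕ) (y : Fin k → E), LinearIndependent ℝ y ∧
      ∀ L₁ L₂, β L₁ L₂ = ∑ i, L₁ (y i) * L₂ (y i) := by
  classical
  obtain ⟨N, e, d, hd, hβe⟩ := exists_basis_eq_sum_mul hβ
  let f := (Fintype.equivFin {i // d i ≠ 0}).symm
  have hsqrt (j) : √(d (f j)) ≠ 0 := (Real.sqrt_pos.2 ((hd _).lt_of_ne' (f j).2)).ne'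
  have hind : LinearIndependent ℝ fun j => e (f j) :=
    e.linearIndependent.comp (fun j => (f j : Fin N)) (Subtype.val_injective.comp f.injective)
  refine ⟨_, fun j => √(d (f j)) • e (f j), hind.units_smul fun j => Units.mk0 _ (hsqrt j),
    fun L₁ L₂ => ?_⟩
  have hterm (i : Fin N) : L₁ (√(d i) • e i) * L₂ (√(d i) • e i) =
      d i * (L₁ (e i) * L₂ (e i)) := by
    rw [map_smul, map_smul, smul_eq_mul, smul_eq_mul, mul_mul_mul_comm, Real.mul_self_sqrt (hd i)]
  simp_rw [hterm]
  rw [f.sum_comp fun i : {i // d i ≠ 0} => d i * (L₁ (e i) * L₂ (e i)),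
    ← Finset.sum_subtype (Finset.univ.filter fun i => d i ≠ 0) (by simp)
      fun i => d i * (L₁ (e i) * L₂ (e i)), hβe]
  exact (Finset.sum_filter_of_ne fun i _ hi => left_ne_zero_of_mul hi).symm

end Factorization

section StdGaussianCovariance

variable {V : Type*} [NormedAddCommGroup V] [InnerProductSpace ℝ V] [FiniteDimensional ℝ V]
  [MeasurableSpace V] [BorelSpace V]

theorem covarianceBilinDual_stdGaussian_innerSL (x : V) (L : StrongDual ℝ V) :
    covarianceBilinDual (stdGaussian V) (innerSL ℝ x) L = L x := by
  obtain ⟨y, rfl⟩ := (InnerProductSpace.toDual ℝ V).surjective L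
  have h := covarianceBilin_eq_covarianceBilinDual (μ := stdGaussian V) x y
  rw [covarianceBilin_stdGaussian] at h
  exact h.symm.trans (real_inner_comm x y).symm

theorem covarianceBilinDual_stdGaussian {ι : Type*} [Fintype ι] (b : OrthonormalBasis ι ℝ V)
    (L₁ L₂ : StrongDual ℝ V) :
    covarianceBilinDual (stdGaussian V) L₁ L₂ = ∑ i, L₁ (b i) * L₂ (b i) := by
  obtain ⟨x, rfl⟩ := (InnerProductSpace.toDual ℝ V).surjective L₁
  calc covarianceBilinDual (stdGaussian V) (innerSL ℝ x) L₂ = L₂ x :=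
        covarianceBilinDual_stdGaussian_innerSL x L₂
    _ = ∑ i, inner ℝ x (b i) * L₂ (b i) := by
        conv_lhs => rw [← b.sum_repr' x]
        simp [real_inner_comm]

end StdGaussianCovariance

section Standardization

variable {E : Type*} [NormedAddCommGroup E] [NormedSpace ℝ E] [FiniteDimensional ℝ E]

theorem exists_injective_map_stdGaussian_eq {β : DualForm E} (hβ : β.toBilinForm.IsPosSemidef) :
    ∃ (k : ℕ) (T : EuclideanSpace ℝ (Fin k) →L[ℝ] E), Function.Injective T ∧
      DualForm.map (covarianceBilinDual (stdGaussian (EuclideanSpace ℝ (Fin k)))) T = β := by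
  obtain ⟨k, y, hy, hβy⟩ := exists_linearIndependent_eq_sum_mul hβ
  let b := EuclideanSpace.basisFun (Fin k) ℝ
  refine ⟨k, LinearMap.toContinuousLinearMap (b.toBasis.constr ℝ y), ?_, ?_⟩
  · refine (injective_iff_map_eq_zero _).2 fun x hx => ?_
    have hsum : ∑ j, x j • y j = 0 := by
      simpa [b, Module.Basis.constr_apply_fintype] using hx
    ext j
    exact Fintype.linearIndependent_iff.1 hy _ hsum j
  · ext L₁ L₂
    rw [DualForm.map_apply, covarianceBilinDual_stdGaussian b, hβy]
    have hb (i) : b.toBasis.constr ℝ y (b i) = y i := by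
      rw [← b.coe_toBasis, Module.Basis.constr_basis]
    simp [hb]

variable [MeasurableSpace E] [BorelSpace E]

theorem integral_id_map_affine_stdGaussian {V : Type*} [NormedAddCommGroup V]
    [InnerProductSpace ℝ V] [FiniteDimensional ℝ V] [MeasurableSpace V] [BorelSpace V]
    (T : V →L[ℝ] E) (m : E) : ∫ x, x ∂((stdGaussian V).map fun v => T v + m) = m := by
  rw [integral_id_map_affine IsGaussian.memLp_two_id, integral_id_stdGaussian, map_zero, zero_add]

theorem exists_isGaussian_of_isPosSemidef (m : E) {β : DualForm E}
    (hβ : β.toBilinForm.IsPosSemidef) :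
    ∃ μ : Measure E, IsGaussian μ ∧ ∫ x, x ∂μ = m ∧ covarianceBilinDual μ = β := by
  obtain ⟨k, T, -, hT⟩ := exists_injective_map_stdGaussian_eq hβ
  refine ⟨_, isGaussian_map_affine (μ := stdGaussian _) T m, ?_, ?_⟩
  · exact integral_id_map_affine_stdGaussian T m
  · rw [covarianceBilinDual_map_affine IsGaussian.memLp_two_id, hT]

theorem exists_injective_eq_map_stdGaussian (μ : Measure E) [IsGaussian μ] :
    ∃ (k : ℕ) (T : EuclideanSpace ℝ (Fin k) →L[ℝ] E) (m : E), Function.Injective T ∧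
      μ = (stdGaussian (EuclideanSpace ℝ (Fin k))).map fun v => T v + m := by
  obtain ⟨k, T, hinj, hT⟩ := exists_injective_map_stdGaussian_eq
    (isPosSemidef_covarianceBilinDual (μ := μ))
  have := isGaussian_map_affine (μ := stdGaussian (EuclideanSpace ℝ (Fin k))) T (∫ x, x ∂μ)
  refine ⟨k, T, ∫ x, x ∂μ, hinj, IsGaussian.ext_covarianceBilinDual ?_ ?_⟩
  · exact (integral_id_map_affine_stdGaussian T _).symm
  · rw [covarianceBilinDual_map_affine IsGaussian.memLp_two_id, hT]

end Standardization

section Regression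

theorem exists_comp_eq_on_orthogonal_ker {H F G : Type*} [NormedAddCommGroup H]
    [InnerProductSpace ℝ H] [NormedAddCommGroup F] [NormedSpace ℝ F] [FiniteDimensional ℝ F]
    [NormedAddCommGroup G] [NormedSpace ℝ G] (T : H →L[ℝ] F) (U : H →L[ℝ] G) :
    ∃ A : F →L[ℝ] G, ∀ v ∈ (LinearMap.ker T.toLinearMap)ᗮ, A (T v) = U v := by
  let K := (LinearMap.ker T.toLinearMap)ᗮ
  have hker : LinearMap.ker (T.toLinearMap ∘ₗ K.subtype) = ⊥ := by
    refine LinearMap.ker_eq_bot'.2 fun v hv => Subtype.ext ?_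
    exact inner_self_eq_zero.1 ((Submodule.mem_orthogonal _ _).1 v.2 v hv)
  obtain ⟨S, hS⟩ := LinearMap.exists_leftInverse_of_injective _ hker
  refine ⟨LinearMap.toContinuousLinearMap (U.toLinearMap ∘ₗ K.subtype ∘ₗ S), fun v hv => ?_⟩
  have hSv : S (T v) = ⟨v, hv⟩ := LinearMap.congr_fun hS ⟨v, hv⟩
  simp [hSv]

variable {F G : Type*} [NormedAddCommGroup F] [NormedSpace ℝ F] [FiniteDimensional ℝ F]
  [MeasurableSpace F] [BorelSpace F] [NormedAddCommGroup G] [NormedSpace ℝ G]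
  [FiniteDimensional ℝ G] [MeasurableSpace G] [BorelSpace G]

theorem exists_indepFun_sub (π : Measure (F × G)) [IsGaussian π] :
    ∃ A : F →L[ℝ] G, IndepFun (fun z : F × G => z.1) (fun z => z.2 - A z.1) π := by
  obtain ⟨k, T, m, -, hπ⟩ := exists_injective_eq_map_stdGaussian π
  obtain ⟨A, hA⟩ := exists_comp_eq_on_orthogonal_ker (.fst ℝ F G ∘L T) (.snd ℝ F G ∘L T)
  let R : F × G →L[ℝ] G := .snd ℝ F G - A ∘L .fst ℝ F G
  refine ⟨A, HasGaussianLaw.indepFun_of_covariance_strongDual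
    (IsGaussian.hasGaussianLaw_id.map_fun ((ContinuousLinearMap.fst ℝ F G).prod R))
    fun L₁ L₂ => ?_⟩
  obtain ⟨x, hx⟩ := (InnerProductSpace.toDual ℝ _).surjective (L₁ ∘L .fst ℝ F G ∘L T)
  have hx_mem : x ∈ (LinearMap.ker (ContinuousLinearMap.fst ℝ F G ∘L T).toLinearMap)ᗮ := by
    refine (Submodule.mem_orthogonal' _ _).2 fun v hv => ?_
    have hv' : (T v).1 = 0 := hv
    calc inner ℝ x v = L₁ (T v).1 := DFunLike.congr_fun hx v
      _ = 0 := by rw [hv', map_zero]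
  calc cov[fun z => L₁ z.1, fun z => L₂ (z.2 - A z.1); π]
      = covarianceBilinDual π (L₁ ∘L .fst ℝ F G) (L₂ ∘L R) :=
        (covarianceBilinDual_eq_covariance (μ := π) IsGaussian.memLp_two_id (L₁ ∘L .fst ℝ F G)
          (L₂ ∘L R)).symm
    _ = covarianceBilinDual (stdGaussian _) (innerSL ℝ x) (L₂ ∘L R ∘L T) := by
        rw [hπ, covarianceBilinDual_map_affine IsGaussian.memLp_two_id]
        exact congrArg (fun L => covarianceBilinDual _ L (L₂ ∘L R ∘L T)) hx.symm
    _ = L₂ ((T x).2 - A (T x).1) := covarianceBilinDual_stdGaussian_innerSL _ _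
    _ = 0 := by
        have hAx : A (T x).1 = (T x).2 := hA x hx_mem
        rw [hAx, sub_self, map_zero]

end Regression

section GaussianAttains

variable {F V : Type*} [NormedAddCommGroup V] [InnerProductSpace ℝ V] [FiniteDimensional ℝ V]
  [MeasurableSpace V] [BorelSpace V]

theorem eq_map_stdGaussian_or_ae_inner_eq_zero (μ : Measure V) [IsGaussian μ] :
    (∃ (e : V ≃L[ℝ] V) (m : V), μ = (stdGaussian V).map fun v => e v + m) ∨
      ∃ (a m : V), a ≠ 0 ∧ ∀ᵐ x ∂μ, inner ℝ a (x - m) = 0 := by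
  obtain ⟨k, T, m, hinj, hμ⟩ := exists_injective_eq_map_stdGaussian μ
  by_cases hrange : LinearMap.range T.toLinearMap = ⊤
  · let e := (LinearEquiv.ofBijective T.toLinearMap ⟨hinj, LinearMap.range_eq_top.1 hrange⟩)
    obtain rfl : Module.finrank ℝ V = k := by simpa using e.finrank_eq.symm
    let b := (stdOrthonormalBasis ℝ V).repr
    refine .inl ⟨b.toContinuousLinearEquiv.trans e.toContinuousLinearEquiv, m, ?_⟩
    rw [hμ, ← stdGaussian_map b, Measure.map_map (by fun_prop) (by fun_prop)]
    rfl
  · obtain ⟨a, ha, ha0⟩ := Submodule.exists_mem_ne_zero_of_ne_bot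
      (mt Submodule.orthogonal_eq_bot_iff.1 hrange)
    refine .inr ⟨a, m, ha0, ?_⟩
    rw [hμ, ae_map_iff (by fun_prop) (measurableSet_eq_fun (by fun_prop) (by fun_prop))]
    refine .of_forall fun v => ?_
    rw [add_sub_cancel_right]
    exact (Submodule.mem_orthogonal' _ _).1 ha _ ⟨v, rfl⟩

variable [NormedAddCommGroup F] [NormedSpace ℝ F] [MeasurableSpace F] [BorelSpace F]

theorem exists_map_residual_eq_prod {π : Measure (F × V)} [IsProbabilityMeasure π] {A : F →L[ℝ] V}
    (hA : IndepFun (fun z : F × V => z.1) (fun z => z.2 - A z.1) π) {e : V ≃L[ℝ] V} {m : V}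
    (hR : π.map (fun z => z.2 - A z.1) = (stdGaussian V).map fun v => e v + m) :
    ∃ θ : RegressionModel F V,
      π.map (fun z => (z.1, θ.residual z)) = π.fst.prod (stdGaussian V) := by
  let θ : RegressionModel F V :=
    { scale := e.symm
      slope := -((e.symm : V →L[ℝ] V) ∘L A)
      shift := -e.symm m }
  have hresidual : θ.residual = (fun v => e.symm (v - m)) ∘ fun z => z.2 - A z.1 := by
    ext1 z
    rw [θ.residual_apply z.1 z.2]
    simp only [θ, ContinuousLinearEquiv.coe_coe, neg_apply, ContinuousLinearMap.coe_comp,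
      Function.comp_apply, map_sub]
    abel
  have hindep : IndepFun (fun z : F × V => z.1) θ.residual π := by
    rw [hresidual]
    exact hA.comp (φ := id) measurable_id (by fun_prop)
  have hlaw : π.map θ.residual = stdGaussian V := by
    rw [hresidual, ← Measure.map_map (by fun_prop) (by fun_prop), hR,
      Measure.map_map (by fun_prop) (by fun_prop)]
    simp [Function.comp_def]
  exact ⟨θ, hlaw ▸ (indepFun_iff_map_prod_eq_prod_map_map (by fun_prop) (by fun_prop)).1 hindep⟩

theorem stdGaussianDiv_eq_gaussianDivBound [FiniteDimensional ℝ F] (π : Measure (F × V))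
    [IsGaussian π] :
    stdGaussianDiv π = gaussianDivBound (∫ z, z ∂π) (covarianceBilinDual π) := by
  have hπ : MemLp id 2 π := IsGaussian.memLp_two_id
  refine le_antisymm ?_ (gaussianDivBound_le_stdGaussianDiv hπ)
  obtain ⟨A, hA⟩ := exists_indepFun_sub π
  have : IsGaussian (π.map fun z => z.2 - A z.1) :=
    isGaussian_map (L := ContinuousLinearMap.snd ℝ F V - A ∘L .fst ℝ F V)
  obtain ⟨e, m, hR⟩ | ⟨a, m, ha, hR⟩ :=
    eq_map_stdGaussian_or_ae_inner_eq_zero (π.map fun z => z.2 - A z.1)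
  · obtain ⟨θ, hθ⟩ := exists_map_residual_eq_prod hA hR
    exact stdGaussianDiv_le_of_map_residual hπ θ hθ
  · rw [gaussianDivBound_eq_top_of_ae_inner_eq_zero hπ A m ha (ae_of_ae_map (by fun_prop) hR)]
    exact le_top

end GaussianAttains

/-! ### Laws with two prescribed marginals -/

section CompatibleForms

variable {E E₁ E₂ : Type*} [NormedAddCommGroup E] [NormedSpace ℝ E]
  [NormedAddCommGroup E₁] [NormedSpace ℝ E₁] [NormedAddCommGroup E₂] [NormedSpace ℝ E₂]
  (p₁ : E →L[ℝ] E₁) (p₂ : E →L[ℝ] E₂)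

/-- The candidate covariances of a random vector `x` such that `p₁ x` and `p₂ x` have the same
covariances as for a random vector with covariance `α`. -/
def compatibleForms (α : DualForm E) : Set (DualForm E) :=
  {β | β.toBilinForm.IsPosSemidef ∧ β.map p₁ = α.map p₁ ∧ β.map p₂ = α.map p₂}

theorem isClosed_setOf_isPosSemidef :
    IsClosed {β : DualForm E | β.toBilinForm.IsPosSemidef} := by
  have heq : {β : DualForm E | β.toBilinForm.IsPosSemidef} =
      {β | ∀ L₁ L₂, β L₁ L₂ = β L₂ L₁} ∩ {β | ∀ L, 0 ≤ β L L} :=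
    Set.ext fun β => ⟨fun h => ⟨h.eq, h.nonneg⟩, fun h => ⟨⟨h.1⟩, ⟨h.2⟩⟩⟩
  rw [heq]
  simp only [Set.ofPred_forall]
  exact (isClosed_iInter fun L₁ => isClosed_iInter fun L₂ =>
    isClosed_eq (by fun_prop) (by fun_prop)).inter
    (isClosed_iInter fun L => isClosed_le continuous_const (by fun_prop))

theorem isClosed_compatibleForms (α : DualForm E) : IsClosed (compatibleForms p₁ p₂ α) :=
  isClosed_setOf_isPosSemidef.inter
    ((isClosed_eq (by fun_prop) continuous_const).inter
      (isClosed_eq (by fun_prop) continuous_const))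

variable {p₁ p₂} [FiniteDimensional ℝ E₁] [FiniteDimensional ℝ E₂]

theorem exists_comp_add_comp_eq_id (hp : Function.Injective (p₁.prod p₂)) :
    ∃ (i₁ : E₁ →L[ℝ] E) (i₂ : E₂ →L[ℝ] E), i₁ ∘L p₁ + i₂ ∘L p₂ = .id ℝ E := by
  obtain ⟨i, hi⟩ := (p₁.prod p₂).toLinearMap.exists_leftInverse_of_injective
    (LinearMap.ker_eq_bot.2 hp)
  let i' := i.toContinuousLinearMap
  refine ⟨i' ∘L .inl ℝ E₁ E₂, i' ∘L .inr ℝ E₁ E₂, ?_⟩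
  ext z
  simpa [i', ← map_add] using LinearMap.congr_fun hi z

theorem isCompact_compatibleForms [FiniteDimensional ℝ E]
    (hp : Function.Injective (p₁.prod p₂)) (α : DualForm E) :
    IsCompact (compatibleForms p₁ p₂ α) := by
  obtain ⟨i₁, i₂, hi⟩ := exists_comp_add_comp_eq_id hp
  have : ProperSpace (DualForm E) := FiniteDimensional.proper ℝ _
  refine Metric.isCompact_of_isClosed_isBounded (isClosed_compatibleForms p₁ p₂ α) <|
    isBounded_iff_forall_norm_le.2 ⟨2 * ‖α‖ * (‖i₁ ∘L p₁‖ ^ 2 + ‖i₂ ∘L p₂‖ ^ 2), ?_⟩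
  rintro β ⟨hβ, h₁, h₂⟩
  refine DualForm.norm_le hβ (by positivity) fun L => ?_
  have hα (P : E →L[ℝ] E) : α (L ∘L P) (L ∘L P) ≤ ‖α‖ * (‖L‖ * ‖P‖) * (‖L‖ * ‖P‖) :=
    (le_abs_self _).trans ((α.le_opNorm₂ _ _).trans (by gcongr <;> exact L.opNorm_comp_le P))
  have hβ₁ : β (L ∘L i₁ ∘L p₁) (L ∘L i₁ ∘L p₁) = α (L ∘L i₁ ∘L p₁) (L ∘L i₁ ∘L p₁) :=
    DFunLike.congr_fun (DFunLike.congr_fun h₁ (L ∘L i₁)) (L ∘L i₁)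
  have hβ₂ : β (L ∘L i₂ ∘L p₂) (L ∘L i₂ ∘L p₂) = α (L ∘L i₂ ∘L p₂) (L ∘L i₂ ∘L p₂) :=
    DFunLike.congr_fun (DFunLike.congr_fun h₂ (L ∘L i₂)) (L ∘L i₂)
  calc β L L = β (L ∘L i₁ ∘L p₁ + L ∘L i₂ ∘L p₂) (L ∘L i₁ ∘L p₁ + L ∘L i₂ ∘L p₂) := by
        rw [← ContinuousLinearMap.comp_add, hi, ContinuousLinearMap.comp_id]
    _ ≤ 2 * (α (L ∘L i₁ ∘L p₁) (L ∘L i₁ ∘L p₁) + α (L ∘L i₂ ∘L p₂) (L ∘L i₂ ∘L p₂)) := by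
        rw [← hβ₁, ← hβ₂]
        exact DualForm.apply_add_le hβ _ _
    _ ≤ 2 * (‖α‖ * (‖L‖ * ‖i₁ ∘L p₁‖) * (‖L‖ * ‖i₁ ∘L p₁‖)
          + ‖α‖ * (‖L‖ * ‖i₂ ∘L p₂‖) * (‖L‖ * ‖i₂ ∘L p₂‖)) := by
        gcongr <;> exact hα _
    _ = 2 * ‖α‖ * (‖i₁ ∘L p₁‖ ^ 2 + ‖i₂ ∘L p₂‖ ^ 2) * ‖L‖ ^ 2 := by ring

end CompatibleForms

section SameMarginals

variable {E E₁ E₂ : Type*} [NormedAddCommGroup E] [NormedSpace ℝ E] [MeasurableSpace E]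
  [NormedAddCommGroup E₁] [NormedSpace ℝ E₁] [MeasurableSpace E₁]
  [NormedAddCommGroup E₂] [NormedSpace ℝ E₂] [MeasurableSpace E₂]

/-- The laws of a random vector `x` for which `p₁ x` and `p₂ x` have the same laws as under `μ`. -/
def sameMarginals (p₁ : E →L[ℝ] E₁) (p₂ : E →L[ℝ] E₂) (μ : ProbabilityMeasure E) :
    Set (ProbabilityMeasure E) :=
  {ν | (ν : Measure E).map p₁ = (μ : Measure E).map p₁ ∧
    (ν : Measure E).map p₂ = (μ : Measure E).map p₂}

variable [FiniteDimensional ℝ E] [BorelSpace E] [BorelSpace E₁] [BorelSpace E₂]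

theorem memLp_id_of_memLp_map {p₁ : E →L[ℝ] E₁} {p₂ : E →L[ℝ] E₂}
    [SecondCountableTopology E₁] [SecondCountableTopology E₂]
    (hp : Function.Injective (p₁.prod p₂)) {ν : Measure E} {r : ℝ≥0∞}
    (h₁ : MemLp id r (ν.map p₁)) (h₂ : MemLp id r (ν.map p₂)) : MemLp id r ν := by
  obtain ⟨K, -, hK⟩ := (p₁.prod p₂).toLinearMap.exists_antilipschitzWith (LinearMap.ker_eq_bot.2 hp)
  have hp₁ : MemLp p₁ r ν :=
    (memLp_map_measure_iff (g := id) (f := p₁) (by fun_prop) (by fun_prop)).1 h₁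
  have hp₂ : MemLp p₂ r ν :=
    (memLp_map_measure_iff (g := id) (f := p₂) (by fun_prop) (by fun_prop)).1 h₂
  have hprod : MemLp (fun x => (p₁ x, p₂ x)) r ν := memLp_prod_iff.2 ⟨hp₁, hp₂⟩
  exact hprod.of_comp_antilipschitzWith (g := p₁.prod p₂) (p₁.prod p₂).uniformContinuous hK
    (map_zero _)

variable [FiniteDimensional ℝ E₁] [FiniteDimensional ℝ E₂]

theorem map_eq_of_moments_eq {μ ν : Measure E} [IsProbabilityMeasure μ] (hμ : MemLp id 2 μ)
    [IsGaussian ν] (T : E →L[ℝ] E₁) [IsGaussian (μ.map T)] (hmean : ∫ x, x ∂ν = ∫ x, x ∂μ)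
    (hcov : DualForm.map (covarianceBilinDual ν) T = DualForm.map (covarianceBilinDual μ) T) :
    ν.map T = μ.map T := by
  have hν : MemLp id 2 ν := IsGaussian.memLp_two_id
  refine IsGaussian.ext_covarianceBilinDual ?_ ?_
  · change ∫ y, y ∂(ν.map T) = ∫ y, y ∂(μ.map T)
    rw [integral_id_map hμ, integral_id_map hν, hmean]
  · rw [covarianceBilinDual_map hμ, covarianceBilinDual_map hν, hcov]

variable {p₁ : E →L[ℝ] E₁} {p₂ : E →L[ℝ] E₂} {μ ν : ProbabilityMeasure E}

theorem integral_id_eq_of_mem_sameMarginals (hp : Function.Injective (p₁.prod p₂))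
    (hμ : MemLp id 2 (μ : Measure E)) (hν : MemLp id 2 (ν : Measure E))
    (h : ν ∈ sameMarginals p₁ p₂ μ) :
    ∫ x, x ∂(ν : Measure E) = ∫ x, x ∂(μ : Measure E) := by
  refine hp (Prod.ext ?_ ?_)
  · change p₁ (∫ x, x ∂(ν : Measure E)) = p₁ (∫ x, x ∂(μ : Measure E))
    rw [← integral_id_map hν, ← integral_id_map hμ, h.1]
  · change p₂ (∫ x, x ∂(ν : Measure E)) = p₂ (∫ x, x ∂(μ : Measure E))
    rw [← integral_id_map hν, ← integral_id_map hμ, h.2]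

theorem covarianceBilinDual_mem_compatibleForms (hμ : MemLp id 2 (μ : Measure E))
    (hν : MemLp id 2 (ν : Measure E)) (h : ν ∈ sameMarginals p₁ p₂ μ) :
    covarianceBilinDual (ν : Measure E) ∈
      compatibleForms p₁ p₂ (covarianceBilinDual (μ : Measure E)) := by
  refine ⟨isPosSemidef_covarianceBilinDual, ?_, ?_⟩
  · rw [← covarianceBilinDual_map hν, h.1, covarianceBilinDual_map hμ]
  · rw [← covarianceBilinDual_map hν, h.2, covarianceBilinDual_map hμ]

theorem exists_isGaussian_mem_sameMarginals [IsGaussian ((μ : Measure E).map p₁)]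
    [IsGaussian ((μ : Measure E).map p₂)] (hμ : MemLp id 2 (μ : Measure E)) {β : DualForm E}
    (hβ : β ∈ compatibleForms p₁ p₂ (covarianceBilinDual (μ : Measure E))) :
    ∃ ν ∈ sameMarginals p₁ p₂ μ, IsGaussian (ν : Measure E) ∧
      ∫ x, x ∂(ν : Measure E) = ∫ x, x ∂(μ : Measure E) ∧
      covarianceBilinDual (ν : Measure E) = β := by
  obtain ⟨hpos, h₁, h₂⟩ := hβ
  obtain ⟨ν, hν, hmean, rfl⟩ := exists_isGaussian_of_isPosSemidef (∫ x, x ∂(μ : Measure E)) hpos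
  exact ⟨⟨ν, inferInstance⟩, ⟨map_eq_of_moments_eq (ν := ν) hμ p₁ hmean h₁,
    map_eq_of_moments_eq (ν := ν) hμ p₂ hmean h₂⟩, hν, hmean, rfl⟩

end SameMarginals

/-! ### Gaussian laws minimize the divergence -/

section Minimizer

variable {E F V : Type*} [NormedAddCommGroup E] [NormedSpace ℝ E] [FiniteDimensional ℝ E]
  [MeasurableSpace E] [BorelSpace E] [NormedAddCommGroup F] [NormedSpace ℝ F]
  [FiniteDimensional ℝ F] [MeasurableSpace F] [BorelSpace F]
  [NormedAddCommGroup V] [InnerProductSpace ℝ V] [FiniteDimensional ℝ V]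
  [MeasurableSpace V] [BorelSpace V] (T : E →L[ℝ] F × V) (c : F × V)

theorem gaussianDivBound_le_stdGaussianDiv_map {μ : Measure E} [IsProbabilityMeasure μ]
    (hμ : MemLp id 2 μ) :
    gaussianDivBound (T (∫ x, x ∂μ) + c) (DualForm.map (covarianceBilinDual μ) T) ≤
      stdGaussianDiv (μ.map fun x => T x + c) := by
  have : IsProbabilityMeasure (μ.map fun x => T x + c) :=
    Measure.isProbabilityMeasure_map (by fun_prop)
  rw [← integral_id_map_affine hμ, ← covarianceBilinDual_map_affine hμ T c]
  exact gaussianDivBound_le_stdGaussianDiv (memLp_id_map_affine hμ T c)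

theorem stdGaussianDiv_map_eq_gaussianDivBound (μ : Measure E) [IsGaussian μ] :
    stdGaussianDiv (μ.map fun x => T x + c) =
      gaussianDivBound (T (∫ x, x ∂μ) + c) (DualForm.map (covarianceBilinDual μ) T) := by
  have := isGaussian_map_affine (μ := μ) T c
  have hμ : MemLp id 2 μ := IsGaussian.memLp_two_id
  rw [← integral_id_map_affine hμ, ← covarianceBilinDual_map_affine hμ T c,
    stdGaussianDiv_eq_gaussianDivBound]

theorem stdGaussianDiv_map_le_of_moments_eq {μ ν : Measure E} [IsProbabilityMeasure μ]
    (hμ : MemLp id 2 μ) [IsGaussian ν] (hmean : ∫ x, x ∂ν = ∫ x, x ∂μ)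
    (hcov : covarianceBilinDual ν = covarianceBilinDual μ) :
    stdGaussianDiv (ν.map fun x => T x + c) ≤ stdGaussianDiv (μ.map fun x => T x + c) := by
  rw [stdGaussianDiv_map_eq_gaussianDivBound, hmean, hcov]
  exact gaussianDivBound_le_stdGaussianDiv_map T c hμ

variable {E₁ E₂ : Type*} [NormedAddCommGroup E₁] [NormedSpace ℝ E₁] [FiniteDimensional ℝ E₁]
  [MeasurableSpace E₁] [BorelSpace E₁] [NormedAddCommGroup E₂] [NormedSpace ℝ E₂]
  [FiniteDimensional ℝ E₂] [MeasurableSpace E₂] [BorelSpace E₂]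
  {p₁ : E →L[ℝ] E₁} {p₂ : E →L[ℝ] E₂}

theorem exists_isMinOn_stdGaussianDiv_map (hp : Function.Injective (p₁.prod p₂))
    (μ : ProbabilityMeasure E) [IsGaussian ((μ : Measure E).map p₁)]
    [IsGaussian ((μ : Measure E).map p₂)] :
    ∃ ν ∈ sameMarginals p₁ p₂ μ, IsGaussian (ν : Measure E) ∧
      IsMinOn (fun ν : ProbabilityMeasure E =>
        stdGaussianDiv ((ν : Measure E).map fun x => T x + c)) (sameMarginals p₁ p₂ μ) ν := by
  have hmoments : ∀ ν ∈ sameMarginals p₁ p₂ μ, MemLp id 2 (ν : Measure E) := by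
    intro ν hν
    refine memLp_id_of_memLp_map hp ?_ ?_
    · exact hν.1 ▸ IsGaussian.memLp_two_id
    · exact hν.2 ▸ IsGaussian.memLp_two_id
  have hμ : MemLp id 2 (μ : Measure E) := hmoments μ ⟨rfl, rfl⟩
  have hcont : LowerSemicontinuous fun β : DualForm E =>
      gaussianDivBound (T (∫ x, x ∂(μ : Measure E)) + c) (β.map T) :=
    (lowerSemicontinuous_gaussianDivBound _).comp (DualForm.continuous_map T)
  obtain ⟨β, hβ, hmin⟩ := (hcont.lowerSemicontinuousOn _).exists_isMinOn
    ⟨_, covarianceBilinDual_mem_compatibleForms hμ hμ ⟨rfl, rfl⟩⟩ (isCompact_compatibleForms hp _)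
  obtain ⟨ν, hν, hgauss, hmean, rfl⟩ := exists_isGaussian_mem_sameMarginals hμ hβ
  refine ⟨ν, hν, hgauss, fun ρ hρ => ?_⟩
  calc stdGaussianDiv ((ν : Measure E).map fun x => T x + c)
    _ = gaussianDivBound (T (∫ x, x ∂(μ : Measure E)) + c)
          (DualForm.map (covarianceBilinDual (ν : Measure E)) T) := by
        rw [stdGaussianDiv_map_eq_gaussianDivBound, hmean]
    _ ≤ gaussianDivBound (T (∫ x, x ∂(ρ : Measure E)) + c)
          (DualForm.map (covarianceBilinDual (ρ : Measure E)) T) := by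
        rw [integral_id_eq_of_mem_sameMarginals hp hμ (hmoments ρ hρ) hρ]
        exact hmin (covarianceBilinDual_mem_compatibleForms hμ (hmoments ρ hρ) hρ)
    _ ≤ stdGaussianDiv ((ρ : Measure E).map fun x => T x + c) :=
        gaussianDivBound_le_stdGaussianDiv_map T c (hmoments ρ hρ)

end Minimizer

/-! ### Conditional mutual information given an independent variable -/

section FibrewiseMap

variable {A B B' C : Type*} [MeasurableSpace A] [MeasurableSpace B] [MeasurableSpace B']
  [MeasurableSpace C] {κ : Kernel C B} [IsSFiniteKernel κ] {s : C × B → B'}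

theorem id_prod_map_apply (hs : Measurable s) (x : C) :
    (Kernel.id ×ₖ κ).map s x = (κ x).map fun v => s (x, v) := by
  rw [Kernel.map_apply _ hs, Kernel.prod_apply, Kernel.id_apply, Measure.dirac_prod,
    Measure.map_map hs (by fun_prop)]
  rfl

theorem compProd_id_prod_map (μ : Measure C) [SFinite μ] (hs : Measurable s) :
    μ ⊗ₘ (Kernel.id ×ₖ κ).map s = (μ ⊗ₘ κ).map fun w => (w.1, s w) := by
  refine Measure.ext_of_lintegral _ fun f hf => ?_
  rw [Measure.lintegral_compProd hf, lintegral_map hf (by fun_prop),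
    Measure.lintegral_compProd (by fun_prop)]
  refine lintegral_congr fun x => ?_
  rw [id_prod_map_apply hs, lintegral_map (by fun_prop) (by fun_prop)]

theorem compProd_prod_id_prod_map (μ : Measure C) [SFinite μ] (η : Kernel C A) [IsSFiniteKernel η]
    (hs : Measurable s) :
    μ ⊗ₘ (η ×ₖ (Kernel.id ×ₖ κ).map s) =
      (μ ⊗ₘ (η ×ₖ κ)).map fun w => (w.1, w.2.1, s (w.1, w.2.2)) := by
  have hkernel : η ×ₖ (Kernel.id ×ₖ κ).map s =
      (Kernel.id ×ₖ (η ×ₖ κ)).map fun w => (w.2.1, s (w.1, w.2.2)) := by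
    ext1 x
    rw [id_prod_map_apply (by fun_prop), Kernel.prod_apply, Kernel.prod_apply,
      id_prod_map_apply hs]
    nth_rewrite 1 [← Measure.map_id (μ := η x)]
    exact Measure.map_prod_map _ _ measurable_id (by fun_prop)
  rw [hkernel, compProd_id_prod_map μ (by fun_prop)]

end FibrewiseMap

section CondMutualInfo

variable {Ω A B B' C : Type*} [MeasurableSpace Ω] [MeasurableSpace A] [StandardBorelSpace A]
  [Nonempty A] [MeasurableSpace B] [StandardBorelSpace B] [Nonempty B] [MeasurableSpace B']
  [StandardBorelSpace B'] [Nonempty B'] [MeasurableSpace C] {P : Measure Ω}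
  [IsProbabilityMeasure P] {U : Ω → A} {V : Ω → B} {Z : Ω → C}

theorem condDistrib_comp_prodMk {s : C × B → B'} (hV : Measurable V) (hZ : Measurable Z)
    (hs : Measurable s) :
    condDistrib (fun ω => s (Z ω, V ω)) Z P =ᵐ[P.map Z]
      (Kernel.id ×ₖ condDistrib V Z P).map s := by
  refine condDistrib_ae_eq_of_measure_eq_compProd Z (by fun_prop) ?_
  rw [compProd_id_prod_map _ hs, compProd_map_condDistrib hV.aemeasurable,
    Measure.map_map (by fun_prop) (by fun_prop)]
  rfl

theorem condMutualInfo_comp_right {s : C × B → B'} {s' : C × B' → B} (hU : Measurable U)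
    (hV : Measurable V) (hZ : Measurable Z) (hs : Measurable s) (hs' : Measurable s')
    (hinv : ∀ z v, s' (z, s (z, v)) = v) :
    condMutualInfo P U (fun ω => s (Z ω, V ω)) Z = condMutualInfo P U V Z := by
  have hjoint : P.map (fun ω => (Z ω, U ω, s (Z ω, V ω))) =
      (P.map fun ω => (Z ω, U ω, V ω)).map fun w => (w.1, w.2.1, s (w.1, w.2.2)) := by
    rw [Measure.map_map (by fun_prop) (by fun_prop)]
    rfl
  have hcond : condDistrib U Z P ×ₖ condDistrib (fun ω => s (Z ω, V ω)) Z P =ᵐ[P.map Z]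
      condDistrib U Z P ×ₖ (Kernel.id ×ₖ condDistrib V Z P).map s := by
    filter_upwards [condDistrib_comp_prodMk (P := P) hV hZ hs] with x hx
    rw [Kernel.prod_apply, Kernel.prod_apply, hx]
  rw [condMutualInfo, condMutualInfo, hjoint, Measure.compProd_congr hcond,
    compProd_prod_id_prod_map _ _ hs]
  exact klDiv_map_eq_of_ae_leftInverse (g' := fun w => (w.1, w.2.1, s' (w.1, w.2.2)))
    (by fun_prop) (by fun_prop) (.of_forall fun w => by simp [hinv])
    (.of_forall fun w => by simp [hinv])

theorem condMutualInfo_eq_mutualInfo_of_indepFun (hU : Measurable U) (hV : Measurable V)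
    (hZ : Measurable Z) (h : IndepFun Z V P) :
    condMutualInfo P U V Z = mutualInfo P (fun ω => (Z ω, U ω)) V := by
  have : IsProbabilityMeasure (P.map V) := Measure.isProbabilityMeasure_map hV.aemeasurable
  have hjoint : P.map (fun ω => (Z ω, U ω, V ω)) =
      (P.map fun ω => ((Z ω, U ω), V ω)).map MeasurableEquiv.prodAssoc := by
    rw [Measure.map_map (by fun_prop) (by fun_prop)]
    rfl
  have hcondV : condDistrib V Z P =ᵐ[P.map Z] Kernel.const C (P.map V) := by
    refine condDistrib_ae_eq_of_measure_eq_compProd Z hV.aemeasurable ?_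
    rw [Measure.compProd_const]
    exact (indepFun_iff_map_prod_eq_prod_map_map hZ.aemeasurable hV.aemeasurable).1 h
  have hcond : condDistrib U Z P ×ₖ condDistrib V Z P =ᵐ[P.map Z]
      condDistrib U Z P ⊗ₖ Kernel.const (C × A) (P.map V) := by
    filter_upwards [hcondV] with x hx
    rw [Kernel.prod_apply, hx, Kernel.compProd_apply_eq_compProd_sectR]
    exact Measure.compProd_const.symm
  rw [condMutualInfo, mutualInfo, hjoint, Measure.compProd_congr hcond, ← Measure.compProd_assoc',
    compProd_map_condDistrib hU.aemeasurable, Measure.compProd_const]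
  exact klDiv_map_eq_of_ae_leftInverse (by fun_prop) MeasurableEquiv.prodAssoc.symm.measurable
    (.of_forall fun w => by simp) (.of_forall fun w => by simp)

end CondMutualInfo

/-! ### Gaussian laws minimize the informations -/

theorem indepFun_comp_of_indepFun_map {Ω Ω' A B : Type*} [MeasurableSpace Ω] [MeasurableSpace Ω']
    [MeasurableSpace A] [MeasurableSpace B] {P : Measure Ω} [IsProbabilityMeasure P] {g : Ω → Ω'}
    {U : Ω' → A} {V : Ω' → B} (hg : Measurable g) (hU : Measurable U) (hV : Measurable V)
    (h : IndepFun U V (P.map g)) : IndepFun (fun ω => U (g ω)) (fun ω => V (g ω)) P := by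
  have : IsProbabilityMeasure (P.map g) := Measure.isProbabilityMeasure_map hg.aemeasurable
  rw [indepFun_iff_map_prod_eq_prod_map_map hU.aemeasurable hV.aemeasurable,
    Measure.map_map (by fun_prop) hg, Measure.map_map hU hg, Measure.map_map hV hg] at h
  exact (indepFun_iff_map_prod_eq_prod_map_map (by fun_prop) (by fun_prop)).2 h

section MutualInfo

variable {Ω A W V : Type*} [MeasurableSpace Ω] [MeasurableSpace A]
  [NormedAddCommGroup W] [NormedSpace ℝ W] [FiniteDimensional ℝ W]
  [MeasurableSpace W] [BorelSpace W]
  [NormedAddCommGroup V] [InnerProductSpace ℝ V] [FiniteDimensional ℝ V]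
  [MeasurableSpace V] [BorelSpace V]

theorem mutualInfo_eq_stdGaussianDiv {P : Measure Ω} [IsProbabilityMeasure P] {X : Ω → A}
    {M : Ω → W} (hX : Measurable X) (hM : Measurable M) {T : V →L[ℝ] W} {S : W →L[ℝ] V} {m : W}
    (hST : Function.LeftInverse S T)
    (hlaw : P.map M = (stdGaussian V).map fun v => T v + m) :
    mutualInfo P X M = stdGaussianDiv (P.map fun ω => (X ω, S (M ω - m))) := by
  have hae : ∀ᵐ y ∂(P.map M), T (S (y - m)) + m = y := by
    rw [hlaw, ae_map_iff (by fun_prop) (measurableSet_eq_fun (by fun_prop) (by fun_prop))]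
    exact .of_forall fun v => by simp [hST v]
  have hstd : (P.map M).map (fun y => S (y - m)) = stdGaussian V := by
    rw [hlaw, Measure.map_map (by fun_prop) (by fun_prop)]
    simp [Function.comp_def, hST _]
  have hjoint : P.map (fun ω => (X ω, S (M ω - m))) =
      (P.map fun ω => (X ω, M ω)).map (Prod.map id fun y => S (y - m)) := by
    rw [Measure.map_map (by fun_prop) (by fun_prop)]
    rfl
  have hprod : (P.map X).prod (stdGaussian V) =
      ((P.map X).prod (P.map M)).map (Prod.map id fun y => S (y - m)) := by
    rw [← Measure.map_prod_map _ _ measurable_id (by fun_prop), Measure.map_id, hstd]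
  rw [stdGaussianDiv, Measure.fst_map_prodMk (by fun_prop), hjoint, hprod]
  refine (klDiv_map_eq_of_ae_leftInverse (g' := Prod.map id fun v => T v + m) (by fun_prop)
    (by fun_prop) ?_ ?_).symm
  · rw [← Measure.snd_map_prodMk hX] at hae
    filter_upwards [ae_of_ae_map measurable_snd.aemeasurable hae] with w hw
    exact Prod.ext rfl hw
  · filter_upwards [Measure.quasiMeasurePreserving_snd.ae hae] with w hw
    exact Prod.ext rfl hw

end MutualInfo

section Minimizer

variable {E F W E₁ E₂ : Type*} [NormedAddCommGroup E] [NormedSpace ℝ E] [FiniteDimensional ℝ E]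
  [MeasurableSpace E] [BorelSpace E] [NormedAddCommGroup F] [NormedSpace ℝ F]
  [FiniteDimensional ℝ F] [MeasurableSpace F] [BorelSpace F]
  [NormedAddCommGroup W] [NormedSpace ℝ W] [FiniteDimensional ℝ W]
  [MeasurableSpace W] [BorelSpace W]
  [NormedAddCommGroup E₁] [NormedSpace ℝ E₁] [FiniteDimensional ℝ E₁]
  [MeasurableSpace E₁] [BorelSpace E₁] [NormedAddCommGroup E₂] [NormedSpace ℝ E₂]
  [FiniteDimensional ℝ E₂] [MeasurableSpace E₂] [BorelSpace E₂]
  {p₁ : E →L[ℝ] E₁} {p₂ : E →L[ℝ] E₂}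

theorem exists_isMinOn_mutualInfo (hp : Function.Injective (p₁.prod p₂))
    (μ : ProbabilityMeasure E) [IsGaussian ((μ : Measure E).map p₁)]
    [IsGaussian ((μ : Measure E).map p₂)] (X : E →L[ℝ] F) (M : E →L[ℝ] W)
    [IsGaussian ((μ : Measure E).map M)]
    (hM : ∀ ν ∈ sameMarginals p₁ p₂ μ, (ν : Measure E).map M = (μ : Measure E).map M) :
    ∃ ν ∈ sameMarginals p₁ p₂ μ, IsGaussian (ν : Measure E) ∧
      IsMinOn (fun ν : ProbabilityMeasure E => mutualInfo (ν : Measure E) X M)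
        (sameMarginals p₁ p₂ μ) ν := by
  obtain ⟨k, T, m, hT, hlaw⟩ := exists_injective_eq_map_stdGaussian ((μ : Measure E).map M)
  obtain ⟨S, hST⟩ := T.toLinearMap.exists_leftInverse_of_injective (LinearMap.ker_eq_bot.2 hT)
  let S' := S.toContinuousLinearMap
  obtain ⟨ν, hν, hgauss, hmin⟩ :=
    exists_isMinOn_stdGaussianDiv_map (X.prod (S' ∘L M)) (0, -S' m) hp μ
  have hdiv : ∀ ρ ∈ sameMarginals p₁ p₂ μ, mutualInfo (ρ : Measure E) X M =
      stdGaussianDiv ((ρ : Measure E).map fun x => X.prod (S' ∘L M) x + (0, -S' m)) := by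
    intro ρ hρ
    rw [mutualInfo_eq_stdGaussianDiv (S := S') (by fun_prop) (by fun_prop)
      (LinearMap.congr_fun hST) ((hM ρ hρ).trans hlaw)]
    simp [sub_eq_add_neg]
  exact ⟨ν, hν, hgauss, hmin.congr (fun ρ hρ => (hdiv ρ hρ).symm) (hdiv ν hν).symm⟩

-- Regressing `V` on `Z` replaces the information given `Z` by one about the residual alone.
theorem exists_isMinOn_condMutualInfo [StandardBorelSpace F] [StandardBorelSpace W]
    {G : Type*} [NormedAddCommGroup G] [NormedSpace ℝ G] [FiniteDimensional ℝ G]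
    [MeasurableSpace G] [BorelSpace G]
    (hp : Function.Injective (p₁.prod p₂)) (μ : ProbabilityMeasure E)
    [IsGaussian ((μ : Measure E).map p₁)] [IsGaussian ((μ : Measure E).map p₂)]
    (U : E →L[ℝ] F) (V : E →L[ℝ] W) (Z : E →L[ℝ] G)
    [IsGaussian ((μ : Measure E).map (Z.prod V))]
    (hZV : ∀ ν ∈ sameMarginals p₁ p₂ μ,
      (ν : Measure E).map (Z.prod V) = (μ : Measure E).map (Z.prod V)) :
    ∃ ν ∈ sameMarginals p₁ p₂ μ, IsGaussian (ν : Measure E) ∧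
      IsMinOn (fun ν : ProbabilityMeasure E => condMutualInfo (ν : Measure E) U V Z)
        (sameMarginals p₁ p₂ μ) ν := by
  obtain ⟨A, hA⟩ := exists_indepFun_sub ((μ : Measure E).map (Z.prod V))
  let N : G × W →L[ℝ] W := .snd ℝ G W - A ∘L .fst ℝ G W
  have hresidual (ρ : ProbabilityMeasure E) :
      (ρ : Measure E).map (N ∘L Z.prod V) = ((ρ : Measure E).map (Z.prod V)).map N := by
    rw [Measure.map_map (by fun_prop) (by fun_prop), ContinuousLinearMap.coe_comp]
  have : IsGaussian ((μ : Measure E).map (N ∘L Z.prod V)) := by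
    rw [hresidual]
    infer_instance
  obtain ⟨ν, hν, hgauss, hmin⟩ := exists_isMinOn_mutualInfo hp μ (Z.prod U) (N ∘L Z.prod V)
    fun ρ hρ => by rw [hresidual, hresidual, hZV ρ hρ]
  have hinfo : ∀ ρ ∈ sameMarginals p₁ p₂ μ, condMutualInfo (ρ : Measure E) U V Z =
      mutualInfo (ρ : Measure E) (Z.prod U) (N ∘L Z.prod V) := by
    intro ρ hρ
    have hindep : IndepFun Z (fun x => V x - A (Z x)) (ρ : Measure E) := by
      rw [← hZV ρ hρ] at hA
      exact indepFun_comp_of_indepFun_map (g := Z.prod V) (by fun_prop) (by fun_prop)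
        (by fun_prop) hA
    rw [← condMutualInfo_comp_right (s := fun w => w.2 - A w.1) (s' := fun w => w.2 + A w.1)
      (by fun_prop) (by fun_prop) (by fun_prop) (by fun_prop) (by fun_prop) (by simp)]
    exact condMutualInfo_eq_mutualInfo_of_indepFun (by fun_prop) (by fun_prop) (by fun_prop) hindep
  exact ⟨ν, hν, hgauss, hmin.congr (fun ρ hρ => (hinfo ρ hρ).symm) (hinfo ν hν).symm⟩

end Minimizer

/-! ### Gaussian optimizers of the decomposition -/

section Optimizers

variable {d₁ d₂ dY : ℕ}

/-- `X₁` as a continuous linear map. -/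
def projX₁ : Triple d₁ d₂ dY →L[ℝ] EuclideanSpace ℝ (Fin d₁) := .fst ℝ _ _

/-- `X₂` as a continuous linear map. -/
def projX₂ : Triple d₁ d₂ dY →L[ℝ] EuclideanSpace ℝ (Fin d₂) := .fst ℝ _ _ ∘L .snd ℝ _ _

/-- `Y` as a continuous linear map. -/
def projY : Triple d₁ d₂ dY →L[ℝ] EuclideanSpace ℝ (Fin dY) := .snd ℝ _ _ ∘L .snd ℝ _ _

/-- The projection `(x₁, x₂, y) ↦ (x₁, y)`, whose law is `marginal₁`. -/
abbrev proj₁ : Triple d₁ d₂ dY →L[ℝ] EuclideanSpace ℝ (Fin d₁) × EuclideanSpace ℝ (Fin dY) :=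
  projX₁.prod projY

/-- The projection `(x₁, x₂, y) ↦ (x₂, y)`, whose law is `marginal₂`. -/
abbrev proj₂ : Triple d₁ d₂ dY →L[ℝ] EuclideanSpace ℝ (Fin d₂) × EuclideanSpace ℝ (Fin dY) :=
  projX₂.prod projY

theorem injective_proj₁_prod_proj₂ :
    Function.Injective ((proj₁ (d₁ := d₁) (d₂ := d₂) (dY := dY)).prod proj₂) :=
  fun _ _ h => Prod.ext (congrArg (fun w => w.1.1) h) (congrArg (fun w => w.2) h)

variable {p q : Law d₁ d₂ dY}

theorem feasible_eq_sameMarginals (hp : p ∈ pairwiseGaussian d₁ d₂ dY) :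
    feasible p = sameMarginals proj₁ proj₂ p := by
  refine Set.Subset.antisymm (fun q hq => hq.2) fun q (hq : marginal₁ q = _ ∧ marginal₂ q = _) => ?_
  exact ⟨⟨hq.1 ▸ hp.1, hq.2 ▸ hp.2⟩, hq⟩

theorem exists_isMinOn_totalInfo (hp : p ∈ pairwiseGaussian d₁ d₂ dY) :
    ∃ q ∈ feasible p, IsJointlyGaussian q ∧ IsMinOn totalInfo (feasible p) q := by
  have : IsGaussian ((p : Measure (Triple d₁ d₂ dY)).map proj₁) := hp.1
  have : IsGaussian ((p : Measure (Triple d₁ d₂ dY)).map proj₂) := hp.2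
  have hY (q : Law d₁ d₂ dY) : (q : Measure (Triple d₁ d₂ dY)).map projY =
      ((q : Measure (Triple d₁ d₂ dY)).map proj₂).map (ContinuousLinearMap.snd ℝ _ _) := by
    rw [Measure.map_map (by fun_prop) (by fun_prop)]
    rfl
  have : IsGaussian ((p : Measure (Triple d₁ d₂ dY)).map projY) := by
    rw [hY]
    infer_instance
  rw [feasible_eq_sameMarginals hp]
  exact exists_isMinOn_mutualInfo injective_proj₁_prod_proj₂ p (projX₁.prod projX₂) projY
    fun q hq => by rw [hY, hY, hq.2]

theorem exists_isMinOn_condInfo₁ (hp : p ∈ pairwiseGaussian d₁ d₂ dY) :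
    ∃ q ∈ feasible p, IsJointlyGaussian q ∧ IsMinOn condInfo₁ (feasible p) q := by
  have : IsGaussian ((p : Measure (Triple d₁ d₂ dY)).map proj₁) := hp.1
  have : IsGaussian ((p : Measure (Triple d₁ d₂ dY)).map proj₂) := hp.2
  rw [feasible_eq_sameMarginals hp]
  exact exists_isMinOn_condMutualInfo injective_proj₁_prod_proj₂ p projX₁ projY projX₂
    fun q hq => hq.2

theorem exists_isMinOn_condInfo₂ (hp : p ∈ pairwiseGaussian d₁ d₂ dY) :
    ∃ q ∈ feasible p, IsJointlyGaussian q ∧ IsMinOn condInfo₂ (feasible p) q := by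
  have : IsGaussian ((p : Measure (Triple d₁ d₂ dY)).map proj₁) := hp.1
  have : IsGaussian ((p : Measure (Triple d₁ d₂ dY)).map proj₂) := hp.2
  rw [feasible_eq_sameMarginals hp]
  exact exists_isMinOn_condMutualInfo injective_proj₁_prod_proj₂ p projX₂ projY projX₁
    fun q hq => hq.1

theorem mutualInfo_X₁_Y_eq_of_mem_feasible (hq : q ∈ feasible p) :
    mutualInfo (q : Measure (Triple d₁ d₂ dY)) X₁ Y =
      mutualInfo (p : Measure (Triple d₁ d₂ dY)) X₁ Y := by
  have hmarginal (q : Law d₁ d₂ dY) : mutualInfo (q : Measure (Triple d₁ d₂ dY)) X₁ Y =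
      klDiv (marginal₁ q) ((marginal₁ q).fst.prod (marginal₁ q).snd) := by
    rw [mutualInfo, marginal₁, Measure.fst_map_prodMk (by unfold Y; fun_prop),
      Measure.snd_map_prodMk (by unfold X₁; fun_prop)]
  rw [hmarginal, hmarginal, hq.2.1]

theorem isMaxOn_interactionInfo (hq : q ∈ feasible p) (hmin : IsMinOn condInfo₁ (feasible p) q) :
    IsMaxOn interactionInfo (feasible p) q := by
  intro q' hq'
  change interactionInfo q' ≤ interactionInfo q
  rw [interactionInfo, interactionInfo, mutualInfo_X₁_Y_eq_of_mem_feasible hq,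
    mutualInfo_X₁_Y_eq_of_mem_feasible hq']
  exact EReal.sub_le_sub le_rfl (EReal.coe_ennreal_le_coe_ennreal_iff.2 (hmin hq'))

theorem exists_isMaxOn_interactionInfo (hp : p ∈ pairwiseGaussian d₁ d₂ dY) :
    ∃ q ∈ feasible p, IsJointlyGaussian q ∧ IsMaxOn interactionInfo (feasible p) q := by
  obtain ⟨q, hq, hG, hmin⟩ := exists_isMinOn_condInfo₁ hp
  exact ⟨q, hq, hG, isMaxOn_interactionInfo hq hmin⟩

theorem gaussianFeasible_eq (hp : p ∈ pairwiseGaussian d₁ d₂ dY) :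
    gaussianFeasible p = {q ∈ feasible p | IsJointlyGaussian q} := by
  rw [feasible_eq_sameMarginals hp]
  exact Set.ext fun _ => and_comm

theorem biInf_sep_eq_biInf_of_isMinOn {α β : Type*} [CompleteLattice β] {f : α → β} {s : Set α}
    {P : α → Prop} (h : ∃ a ∈ s, P a ∧ IsMinOn f s a) :
    ⨅ x ∈ {x ∈ s | P x}, f x = ⨅ x ∈ s, f x := by
  obtain ⟨a, ha, hPa, hmin⟩ := h
  refine le_antisymm (le_iInf₂ fun x hx => ?_) (biInf_mono fun x hx => hx.1)
  exact (iInf₂_le a ⟨ha, hPa⟩).trans (hmin hx)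

theorem tildeGpid_eq_gpid (hp : p ∈ pairwiseGaussian d₁ d₂ dY) : tildeGpid p = gpid p := by
  have hcoe : Monotone ((↑) : ℝ≥0∞ → EReal) := EReal.coe_ennreal_strictMono.monotone
  have hmin {f : Law d₁ d₂ dY → ℝ≥0∞}
      (h : ∃ q ∈ feasible p, IsJointlyGaussian q ∧ IsMinOn f (feasible p) q) :
      ⨅ q ∈ gaussianFeasible p, (f q : EReal) = ⨅ q ∈ feasible p, (f q : EReal) := by
    obtain ⟨q, hq, hG, hmin⟩ := h
    rw [gaussianFeasible_eq hp]
    exact biInf_sep_eq_biInf_of_isMinOn ⟨q, hq, hG, hmin.comp_mono hcoe⟩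
  ext1
  · change ⨆ q ∈ gaussianFeasible p, interactionInfo q = ⨆ q ∈ feasible p, interactionInfo q
    rw [gaussianFeasible_eq hp]
    exact biInf_sep_eq_biInf_of_isMinOn (β := ERealᵒᵈ) (exists_isMaxOn_interactionInfo hp)
  · exact hmin (exists_isMinOn_condInfo₁ hp)
  · exact hmin (exists_isMinOn_condInfo₂ hp)
  · exact congrArg ((totalInfo p : EReal) - ·) (hmin (exists_isMinOn_totalInfo hp))

end Optimizers

/-! ### Conditional differential entropy as a divergence -/

section PosNegParts

variable {α : Type*} [MeasurableSpace α] {μ : Measure α} {f : α → ℝ}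

theorem lintegral_ofReal_sub_lintegral_ofReal_neg (hf : Integrable f μ) :
    ((∫⁻ x, ENNReal.ofReal (f x) ∂μ : ℝ≥0∞) : EReal) -
      ((∫⁻ x, ENNReal.ofReal (-f x) ∂μ : ℝ≥0∞) : EReal) = ((∫ x, f x ∂μ : ℝ) : EReal) := by
  have hneg : ∫⁻ x, ENNReal.ofReal (-f x) ∂μ ≠ ∞ := hf.neg.lintegral_lt_top.ne
  rw [integral_eq_lintegral_pos_part_sub_lintegral_neg_part hf, EReal.coe_sub,
    EReal.coe_ennreal_toReal hf.lintegral_lt_top.ne, EReal.coe_ennreal_toReal hneg]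

theorem lintegral_ofReal_neg_eq_top (hf : AEMeasurable f μ) (hf_int : ¬ Integrable f μ)
    (hpos : ∫⁻ x, ENNReal.ofReal (f x) ∂μ ≠ ∞) : ∫⁻ x, ENNReal.ofReal (-f x) ∂μ = ∞ := by
  by_contra hneg
  refine hf_int ⟨hf.aestronglyMeasurable, ?_⟩
  calc ∫⁻ x, ‖f x‖ₑ ∂μ
      ≤ ∫⁻ x, ENNReal.ofReal (f x) + ENNReal.ofReal (-f x) ∂μ := by
        refine lintegral_mono fun x => ?_
        rw [Real.enorm_eq_ofReal_abs]
        rcases abs_cases (f x) with ⟨h, -⟩ | ⟨h, -⟩ <;> rw [h]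
        exacts [le_self_add, le_add_self]
    _ = ∫⁻ x, ENNReal.ofReal (f x) ∂μ + ∫⁻ x, ENNReal.ofReal (-f x) ∂μ :=
        lintegral_add_left' hf.ennreal_ofReal _
    _ < ∞ := ENNReal.add_lt_top.2 ⟨Ne.lt_top hpos, Ne.lt_top hneg⟩

end PosNegParts

theorem negMulLog_le_add_mul_abs_log {t a : ℝ} (ht : 0 ≤ t) (ha : 0 < a) :
    Real.negMulLog t ≤ a + t * |Real.log a| := by
  rcases ht.eq_or_lt with rfl | ht
  · simpa using ha.le
  have hlog : t * Real.log (a / t) ≤ a - t := by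
    calc t * Real.log (a / t) ≤ t * (a / t - 1) := by
          gcongr
          exact Real.log_le_sub_one_of_pos (div_pos ha ht)
      _ = a - t := by field_simp
  rw [Real.log_div ha.ne' ht.ne'] at hlog
  have habs : -(t * |Real.log a|) ≤ t * Real.log a := by
    rw [← mul_neg]
    gcongr
    exact neg_abs_le _
  rw [Real.negMulLog]
  linarith

section Entropy

variable {α : Type*} [MeasurableSpace α] {π ξ : Measure α} [SigmaFinite π] [SigmaFinite ξ]

theorem integrable_negMulLog_rnDeriv_iff (hac : π ≪ ξ) :
    Integrable (fun x => Real.negMulLog (π.rnDeriv ξ x).toReal) ξ ↔ Integrable (llr π ξ) π := by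
  rw [← integrable_rnDeriv_mul_log_iff hac]
  simp only [Real.negMulLog, neg_mul]
  exact integrable_neg_iff

theorem integral_negMulLog_rnDeriv (hac : π ≪ ξ) :
    ∫ x, Real.negMulLog (π.rnDeriv ξ x).toReal ∂ξ = -∫ x, llr π ξ x ∂π := by
  simp only [Real.negMulLog, neg_mul, integral_neg, integral_rnDeriv_mul_log hac]

variable {φ : α → ℝ}

theorem llr_withDensity_right (hφ : Measurable φ) (hφ_pos : ∀ x, 0 < φ x) (hac : π ≪ ξ) :
    llr π (ξ.withDensity fun x => ENNReal.ofReal (φ x)) =ᵐ[π]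
      fun x => llr π ξ x - Real.log (φ x) := by
  filter_upwards [hac.ae_le (Measure.rnDeriv_withDensity_right π ξ
    hφ.ennreal_ofReal.aemeasurable (.of_forall fun x => by simp [hφ_pos x]) (by simp)),
    Measure.rnDeriv_pos hac, hac.ae_le (Measure.rnDeriv_ne_top π ξ)] with x hx hpos htop
  rw [llr, hx, llr, ENNReal.toReal_mul, ENNReal.toReal_inv, ENNReal.toReal_ofReal (hφ_pos x).le,
    Real.log_mul (inv_ne_zero (hφ_pos x).ne') (ENNReal.toReal_pos hpos.ne' htop).ne',
    Real.log_inv]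
  ring

theorem lintegral_ofReal_negMulLog_rnDeriv_ne_top (hφ : Measurable φ) (hφ_pos : ∀ x, 0 < φ x)
    (hφ_fin : ∫⁻ x, ENNReal.ofReal (φ x) ∂ξ ≠ ∞)
    (hlog : Integrable (fun x => Real.log (φ x)) π) (hac : π ≪ ξ) :
    ∫⁻ x, ENNReal.ofReal (Real.negMulLog (π.rnDeriv ξ x).toReal) ∂ξ ≠ ∞ := by
  have hbound : ∀ᵐ x ∂ξ, ENNReal.ofReal (Real.negMulLog (π.rnDeriv ξ x).toReal) ≤
      ENNReal.ofReal (φ x) + π.rnDeriv ξ x * ‖Real.log (φ x)‖ₑ := by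
    filter_upwards [Measure.rnDeriv_ne_top π ξ] with x hx
    rw [Real.enorm_eq_ofReal_abs]
    nth_rewrite 2 [← ENNReal.ofReal_toReal hx]
    rw [← ENNReal.ofReal_mul ENNReal.toReal_nonneg,
      ← ENNReal.ofReal_add (hφ_pos x).le (by positivity)]
    exact ENNReal.ofReal_le_ofReal
      (negMulLog_le_add_mul_abs_log ENNReal.toReal_nonneg (hφ_pos x))
  refine ((lintegral_mono_ae hbound).trans_lt ?_).ne
  rw [lintegral_add_left hφ.ennreal_ofReal, lintegral_rnDeriv_mul hac (by fun_prop)]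
  exact ENNReal.add_lt_top.2 ⟨hφ_fin.lt_top, hlog.2⟩

theorem lintegral_ofReal_negMulLog_sub_eq_sub_klDiv {π : Measure α} [IsProbabilityMeasure π]
    (hφ : Measurable φ) (hφ_pos : ∀ x, 0 < φ x)
    [IsProbabilityMeasure (ξ.withDensity fun x => ENNReal.ofReal (φ x))]
    (hlog : Integrable (fun x => Real.log (φ x)) π) (hac : π ≪ ξ) :
    ((∫⁻ x, ENNReal.ofReal (Real.negMulLog (π.rnDeriv ξ x).toReal) ∂ξ : ℝ≥0∞) : EReal) -
      ((∫⁻ x, ENNReal.ofReal (-Real.negMulLog (π.rnDeriv ξ x).toReal) ∂ξ : ℝ≥0∞) : EReal) =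
    ((-∫ x, Real.log (φ x) ∂π : ℝ) : EReal) -
      (klDiv π (ξ.withDensity fun x => ENNReal.ofReal (φ x)) : EReal) := by
  set γ := ξ.withDensity fun x => ENNReal.ofReal (φ x)
  have hac' : π ≪ γ := hac.trans (withDensity_absolutelyContinuous'
    hφ.ennreal_ofReal.aemeasurable (.of_forall fun x => by simp [hφ_pos x]))
  have hllr : llr π γ =ᵐ[π] llr π ξ - fun x => Real.log (φ x) :=
    llr_withDensity_right hφ hφ_pos hac
  have hint_iff : Integrable (llr π γ) π ↔ Integrable (llr π ξ) π := by
    rw [integrable_congr hllr, sub_eq_add_neg, integrable_add_iff_integrable_left hlog.neg]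
  by_cases hint : Integrable (llr π ξ) π
  · have hkl : (klDiv π γ).toReal = ∫ x, llr π ξ x ∂π - ∫ x, Real.log (φ x) ∂π := by
      rw [toReal_klDiv_of_measure_eq hac' (by simp), integral_congr_ae hllr,
        integral_sub' hint hlog]
    rw [lintegral_ofReal_sub_lintegral_ofReal_neg ((integrable_negMulLog_rnDeriv_iff hac).2 hint),
      integral_negMulLog_rnDeriv hac,
      ← EReal.coe_ennreal_toReal (klDiv_ne_top hac' (hint_iff.2 hint)), hkl, ← EReal.coe_sub]
    congr 1
    ring
  · have hfin : ∫⁻ x, ENNReal.ofReal (φ x) ∂ξ ≠ ∞ := by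
      rw [← setLIntegral_univ, ← withDensity_apply _ .univ]
      exact measure_ne_top γ _
    have hmeas : Measurable fun x => Real.negMulLog (π.rnDeriv ξ x).toReal :=
      Real.continuous_negMulLog.measurable.comp (Measure.measurable_rnDeriv π ξ).ennreal_toReal
    rw [lintegral_ofReal_neg_eq_top hmeas.aemeasurable
        (mt (integrable_negMulLog_rnDeriv_iff hac).1 hint)
        (lintegral_ofReal_negMulLog_rnDeriv_ne_top hφ hφ_pos hfin hlog hac),
      klDiv_of_not_integrable (mt hint_iff.1 hint)]
    simp

theorem condDiffEntropy_eq_sub_stdGaussianDiv {Ω A : Type*} [MeasurableSpace Ω]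
    [MeasurableSpace A] {n : ℕ} {P : Measure Ω} [IsProbabilityMeasure P]
    {V : Ω → EuclideanSpace ℝ (Fin n)} {U : Ω → A} (hV : Measurable V) (hU : Measurable U)
    (hsq : Integrable (fun ω => ‖V ω‖ ^ 2) P) :
    condDiffEntropy P V U =
      ((n / 2 * Real.log (2 * Real.pi) + 1 / 2 * ∫ ω, ‖V ω‖ ^ 2 ∂P : ℝ) : EReal) -
      (stdGaussianDiv (P.map fun ω => (U ω, V ω)) : EReal) := by
  have : IsProbabilityMeasure (P.map U) := Measure.isProbabilityMeasure_map (by fun_prop)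
  have : IsProbabilityMeasure (P.map fun ω => (U ω, V ω)) :=
    Measure.isProbabilityMeasure_map (by fun_prop)
  let φ : A × EuclideanSpace ℝ (Fin n) → ℝ := fun z => stdGaussianDensity z.2
  have hφ : Measurable φ := by fun_prop
  have hlogφ (ω : Ω) :
      Real.log (φ (U ω, V ω)) = -(n / 2 * Real.log (2 * Real.pi)) - 1 / 2 * ‖V ω‖ ^ 2 := by
    rw [log_stdGaussianDensity, finrank_euclideanSpace_fin, neg_mul]
  have hprod : (P.map U).prod (stdGaussian _) =
      ((P.map U).prod volume).withDensity fun z => ENNReal.ofReal (φ z) := by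
    rw [stdGaussian_eq_withDensity, prod_withDensity_right (by fun_prop)]
  have : IsProbabilityMeasure
      (((P.map U).prod volume).withDensity fun z => ENNReal.ofReal (φ z)) := by
    rw [← hprod]
    infer_instance
  rw [condDiffEntropy, stdGaussianDiv, Measure.fst_map_prodMk hV, hprod]
  split_ifs with hac
  · have hlog : Integrable (fun z => Real.log (φ z)) (P.map fun ω => (U ω, V ω)) := by
      rw [integrable_map_measure hφ.log.aestronglyMeasurable (by fun_prop)]
      simp only [Function.comp_def, hlogφ]
      exact (integrable_const _).sub (hsq.const_mul _)
    refine (lintegral_ofReal_negMulLog_sub_eq_sub_klDiv hφ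
      (fun w => stdGaussianDensity_pos w.2) hlog hac).trans ?_
    rw [integral_map (by fun_prop) hφ.log.aestronglyMeasurable]
    simp only [hlogφ]
    rw [integral_sub (integrable_const _) (hsq.const_mul _), integral_const_mul, integral_const,
      probReal_univ, one_smul, neg_sub, sub_neg_eq_add, add_comm]
  · rw [klDiv_of_not_ac fun h => hac (h.trans (withDensity_absolutelyContinuous _ _)),
      EReal.coe_ennreal_top, EReal.sub_top]

variable {d₁ d₂ dY : ℕ} {q q' : Law d₁ d₂ dY}

theorem entropyYGivenX_eq (hq : HasFiniteMoments q) :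
    entropyYGivenX q =
      ((dY / 2 * Real.log (2 * Real.pi) + 1 / 2 * sqMoment
        (projY (∫ z, z ∂(q : Measure (Triple d₁ d₂ dY))))
        (DualForm.map (covarianceBilinDual (q : Measure (Triple d₁ d₂ dY))) projY) : ℝ) : EReal) -
      (stdGaussianDiv ((q : Measure (Triple d₁ d₂ dY)).map
        ((projX₁.prod projX₂).prod projY)) : EReal) := by
  have hq' : MemLp id 2 (q : Measure (Triple d₁ d₂ dY)) := hq
  have hY : MemLp projY 2 (q : Measure (Triple d₁ d₂ dY)) := projY.comp_memLp' hq'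
  have : IsProbabilityMeasure ((q : Measure (Triple d₁ d₂ dY)).map projY) :=
    Measure.isProbabilityMeasure_map (by fun_prop)
  have hsq : ∫ z, ‖projY z‖ ^ 2 ∂(q : Measure (Triple d₁ d₂ dY)) = sqMoment
      (projY (∫ z, z ∂(q : Measure (Triple d₁ d₂ dY))))
      (DualForm.map (covarianceBilinDual (q : Measure (Triple d₁ d₂ dY))) projY) := by
    rw [← integral_id_map hq', ← covarianceBilinDual_map hq', ← integral_norm_sq_eq_sqMoment,
      integral_map (by fun_prop) (by fun_prop)]
    exact (memLp_map_measure_iff (g := id) (by fun_prop) (by fun_prop)).2 hY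
  rw [← hsq]
  exact condDiffEntropy_eq_sub_stdGaussianDiv projY.continuous.measurable
    (projX₁.prod projX₂).continuous.measurable (hY.integrable_norm_pow (by norm_num))

theorem entropyYGivenX_le_of_isGaussianMatch (hq : HasFiniteMoments q)
    (h : IsGaussianMatch q q') : entropyYGivenX q ≤ entropyYGivenX q' := by
  obtain ⟨hG, hmean, hcov⟩ := h
  have : IsGaussian (q' : Measure (Triple d₁ d₂ dY)) := hG
  have hdiv := stdGaussianDiv_map_le_of_moments_eq ((projX₁.prod projX₂).prod projY) 0 hq hmean hcov
  simp only [add_zero] at hdiv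
  rw [entropyYGivenX_eq hq, entropyYGivenX_eq IsGaussian.memLp_two_id, hmean, hcov]
  exact EReal.sub_le_sub le_rfl (EReal.coe_ennreal_le_coe_ennreal_iff.2 hdiv)

theorem exists_isGaussianMatch (q : Law d₁ d₂ dY) : ∃ q' : Law d₁ d₂ dY, IsGaussianMatch q q' := by
  obtain ⟨μ, hμ, hmean, hcov⟩ := exists_isGaussian_of_isPosSemidef
    (∫ z, z ∂(q : Measure (Triple d₁ d₂ dY)))
    (isPosSemidef_covarianceBilinDual (μ := (q : Measure (Triple d₁ d₂ dY))))
  exact ⟨⟨μ, inferInstance⟩, hμ, hmean, hcov⟩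

end Entropy

end

end GPID

theorem lemma3p2 (d₁ d₂ dY : ℕ) :
    -- the Gaussian law with the same moments exists and has the larger conditional entropy
    (∀ q : GPID.Law d₁ d₂ dY, GPID.HasFiniteMoments q →
      (∃ q' : GPID.Law d₁ d₂ dY, GPID.IsGaussianMatch q q') ∧
      ∀ q' : GPID.Law d₁ d₂ dY, GPID.IsGaussianMatch q q' →
        GPID.entropyYGivenX q ≤ GPID.entropyYGivenX q') ∧
    -- GPID has jointly Gaussian optimizers, and equals the Gaussian-restricted decomposition
    (∀ p ∈ GPID.pairwiseGaussian d₁ d₂ dY,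
      (∃ q ∈ GPID.feasible p, GPID.IsJointlyGaussian q ∧
        IsMinOn GPID.totalInfo (GPID.feasible p) q) ∧
      (∃ q ∈ GPID.feasible p, GPID.IsJointlyGaussian q ∧
        IsMinOn GPID.condInfo₁ (GPID.feasible p) q) ∧
      (∃ q ∈ GPID.feasible p, GPID.IsJointlyGaussian q ∧
        IsMinOn GPID.condInfo₂ (GPID.feasible p) q) ∧
      (∃ q ∈ GPID.feasible p, GPID.IsJointlyGaussian q ∧
        IsMaxOn GPID.interactionInfo (GPID.feasible p) q) ∧
      GPID.tildeGpid p = GPID.gpid p) := by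
  refine ⟨fun q hq => ⟨GPID.exists_isGaussianMatch q,
    fun q' h => GPID.entropyYGivenX_le_of_isGaussianMatch hq h⟩, fun p hp => ?_⟩
  exact ⟨GPID.exists_isMinOn_totalInfo hp, GPID.exists_isMinOn_condInfo₁ hp,
    GPID.exists_isMinOn_condInfo₂ hp, GPID.exists_isMaxOn_interactionInfo hp,
    GPID.tildeGpid_eq_gpid hp⟩
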